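/- Let $F$ be a fixed finite forest with at least one edge, let $T_1,\dots,T_z$ be its connected components, and let $\theta=\max_{1\le i\le z}\operatorname{odd}(T_i)$, where $\operatorname{odd}(G)$ denotes the number of vertices of odd degree of a graph $G$. For $n\ge 1$ let $X_0,X_1,\dots$ be the lazy simple random walk on the complete graph $K_n$: $X_0$ is a uniformly random vertex and, for each $s\ge 0$, $X_{s+1}$ is chosen uniformly at random from the set consisting of $X_s$ and its neighbours, independently of the past. For $t\ge 0$ let $\Gamma_t$ be the trace of the walk of length $t$, that is, the simple graph on the vertex set of $K_n$ with edge set $\{\{X_{s-1},X_s\} : 0<s\le t,\ X_{s-1}\neq X_s\}$. Then, for every sequence of lengths $t=t(n)\in\mathbb{Z}_{\ge 0}$, $$\lim_{n\to\infty}\Pr[F\subseteq\Gamma_t]=\begin{cases}0 & \text{if } t/n^{1-2/\theta}\to 0,\\ 1 & \text{if } t/n^{1-2/\theta}\to\infty,\end{cases}$$ where $F\subseteq\Gamma_t$ means that $\Gamma_t$ contains a (not necessarily induced) copy of $F$ as a subgraph. -/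

import Mathlib

open Filter Topology

noncomputable section

namespace WalkTrace

/-- The number of vertices of odd degree of a (finite) graph. -/
def oddCount {V : Type*} (G : SimpleGraph V) : ℕ :=
  Set.ncard {v : V | Odd (G.neighborSet v).ncard}

open Classical in
/-- The closed neighbourhood of `v`: the vertex `v` together with its neighbours. -/
def closedNbhd {V : Type*} [Fintype V] (G : SimpleGraph V) (v : V) : Finset V :=
  insert v (G.neighborFinset v)

theorem closedNbhd_nonempty {V : Type*} [Fintype V] (G : SimpleGraph V) (v : V) :
    (closedNbhd G v).Nonempty :=
  ⟨v, by simp [closedNbhd]⟩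

/-- The law of the first `t` steps `(X 0, …, X t)` of the lazy simple random walk on `G`:
`X 0` is uniform on the vertices and, given `X 0, …, X s`, the next location `X (s + 1)` is uniform
on the closed neighbourhood of `X s`. -/
def walkLaw {V : Type*} [Fintype V] [Nonempty V] (G : SimpleGraph V) :
    (t : ℕ) → PMF (Fin (t + 1) → V)
  | 0 => (PMF.uniformOfFintype V).map fun v _ => v
  | t + 1 => (walkLaw G t).bind fun x =>
      (PMF.uniformOfFinset (closedNbhd G (x (Fin.last t))) (closedNbhd_nonempty G _)).map
        fun v => (Fin.snoc (α := fun _ => V) x v : Fin (t + 1 + 1) → V)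

/-- The trace of a trajectory `(x 0, …, x t)`: the graph on the same vertex set whose edges are the
traversed pairs `{x (s - 1), x s}`, `0 < s ≤ t`. Loops are discarded by `fromEdgeSet`. -/
def trace {V : Type*} {t : ℕ} (x : Fin (t + 1) → V) : SimpleGraph V :=
  SimpleGraph.fromEdgeSet {e | ∃ s : Fin t, e = s(x s.castSucc, x s.succ)}

/-- The law of the trace `Γ_t` of a lazy simple random walk of length `t` on `G`. -/
def traceLaw {V : Type*} [Fintype V] [Nonempty V] (G : SimpleGraph V) (t : ℕ) :
    PMF (SimpleGraph V) :=
  (walkLaw G t).map trace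

/-- The probability that the trace of a lazy simple random walk of length `t` on `G` contains
a copy of `F`, as a not necessarily induced subgraph. -/
def containProb {W V : Type*} [Fintype V] [Nonempty V]
    (F : SimpleGraph W) (G : SimpleGraph V) (t : ℕ) : ENNReal :=
  (traceLaw G t).toOuterMeasure {H | F.IsContained H}

end WalkTrace

end

/-! On the complete graph every closed neighbourhood is the whole vertex set, so the walk is a
sequence of independent uniform vertices and every probability is a count of functions divided by `n
^ (t + 1)`.

Lower side. Let `T` be a component with `θ` odd vertices and `e` edges. A copy of `T` in the trace
selects one time for each edge of `T`. These times split into `k` runs of consecutive times, and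
each run is a trail in `T`; only its two ends can unbalance a degree, so `θ ≤ 2k`
(`TracesEdges.oddCount_le`). There are `O(t ^ k)` such sets of times (`card_filter_runStarts_le`),
each involves `e + k` positions, and `T` has at most `e + 1` vertices. The expected number of copies
with `k` runs is thus `O(n (t/n) ^ k)`. For `t ≤ n` the exponent `θ/2` bounds every term, and `n
(t/n) ^ (θ/2) = (t / n ^ (1 - 2/θ)) ^ (θ/2)`.

Upper side. Removing longest paths one by one decomposes the forest into trails, with each odd
vertex an end of at most one trail (`exists_isTrailDecomposition`). Reserve for each trail `m`, of
order `t`, disjoint time windows, and count the pairs of a choice of windows and an embedding of the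
forest for which the walk follows the trails. Two choices that share the windows of a set `J` of
trails are correlated by a factor `n` to the power (positions in `J`) minus (vertices of `J`). In a
forest the vertices of `J` number at least its edges plus the components it meets, and a component
holds at most `θ/2` trails, so the factor is at most `c ^ |J|` with `c = n ^ (1 - 2/θ)`
(`IsTrailDecomposition.sparse`). The second moment method (`second_moment`) then gives probability
at least `(1 - o(1)) (m / (m + c)) ^ K` for `K` trails, which tends to 1 once `t / c` tends to
infinity. -/

namespace WalkTrace

/-! ### The lazy walk on a complete graph as independent uniform vertices -/

section Uniform

theorem closedNbhd_top {V : Type*} [Fintype V] (v : V) :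
    closedNbhd (⊤ : SimpleGraph V) v = Finset.univ := by
  ext w
  simp only [closedNbhd, Finset.mem_insert, SimpleGraph.mem_neighborFinset, SimpleGraph.top_adj,
    Finset.mem_univ, iff_true]
  exact (eq_or_ne w v).imp id Ne.symm

/-- On a complete graph the lazy walk is a sequence of independent uniform vertices. -/
theorem walkLaw_top_apply {V : Type*} [Fintype V] [Nonempty V] (t : ℕ) (x : Fin (t + 1) → V) :
    walkLaw (⊤ : SimpleGraph V) t x = ((Fintype.card V : ENNReal)⁻¹) ^ (t + 1) := by
  classical
  induction t with
  | zero =>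
    rw [walkLaw, PMF.map_apply, tsum_eq_single (x 0)]
    · rw [if_pos (funext fun i => congrArg x (Subsingleton.elim (α := Fin 1) i 0)),
        PMF.uniformOfFintype_apply]
      simp
    · intro v hv
      exact if_neg fun h => hv (by rw [h])
  | succ t ih =>
    rw [walkLaw, PMF.bind_apply, tsum_eq_single (Fin.init x)]
    · rw [ih, PMF.map_apply, tsum_eq_single (x (Fin.last (t + 1)))]
      · rw [if_pos (Fin.snoc_init_self x).symm, PMF.uniformOfFinset_apply,
          if_pos (by rw [closedNbhd_top]; exact Finset.mem_univ _), closedNbhd_top,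
          Finset.card_univ]
        rw [pow_succ _ (t + 1)]
      · intro v hv
        refine if_neg fun h => hv ?_
        rw [h, Fin.snoc_last]
    · intro y hy
      rw [PMF.map_apply]
      refine mul_eq_zero_of_right _ (ENNReal.tsum_eq_zero.2 fun v => if_neg fun h => hy ?_)
      rw [h, Fin.init_snoc]

open Classical in
theorem containProb_top {W V : Type*} [Fintype V] [Nonempty V] (F : SimpleGraph W) (t : ℕ) :
    containProb F (⊤ : SimpleGraph V) t = ENNReal.ofReal
      (((Finset.univ.filter fun x : Fin (t + 1) → V => F.IsContained (trace x)).card : ℝ) /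
        (Fintype.card V : ℝ) ^ (t + 1)) := by
  have hpos : (0 : ℝ) < Fintype.card V := by exact_mod_cast Fintype.card_pos
  rw [containProb, traceLaw, PMF.toOuterMeasure_map_apply, PMF.toOuterMeasure_apply_fintype,
    div_eq_mul_inv, ENNReal.ofReal_mul (by positivity), ENNReal.ofReal_natCast,
    ENNReal.ofReal_inv_of_pos (by positivity), ENNReal.ofReal_pow hpos.le, ENNReal.ofReal_natCast,
    Finset.card_filter, Nat.cast_sum, Finset.sum_mul]
  refine Finset.sum_congr rfl fun x _ => ?_
  rw [Set.indicator_apply, walkLaw_top_apply, ENNReal.inv_pow]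
  by_cases h : F.IsContained (trace x)
  · rw [if_pos (by exact h), if_pos h, Nat.cast_one, one_mul]
  · rw [if_neg (by exact h), if_neg h, Nat.cast_zero, zero_mul]

end Uniform

/-! ### Counting functions with prescribed values -/

section Cylinder

open Classical in
/-- The number of functions with prescribed values on a given set. -/
theorem card_cylinder {ι α : Type*} [Fintype ι] [Fintype α] (P : Finset ι) (f : ι → α) :
    (Finset.univ.filter fun x : ι → α => ∀ p ∈ P, x p = f p).card * Fintype.card α ^ P.card =
      Fintype.card α ^ Fintype.card ι := by
  have h : (Finset.univ.filter fun x : ι → α => ∀ p ∈ P, x p = f p) =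
      Fintype.piFinset fun i => if i ∈ P then {f i} else Finset.univ := by
    ext x
    simp only [Finset.mem_filter, Finset.mem_univ, true_and, Fintype.mem_piFinset]
    refine forall_congr' fun i => ?_
    by_cases hi : i ∈ P <;> simp [hi]
  have h2 : ∀ i, (if i ∈ P then {f i} else Finset.univ : Finset α).card =
      if i ∈ P then 1 else Fintype.card α := by
    intro i; split_ifs <;> simp
  rw [h, Fintype.card_piFinset, Finset.prod_congr rfl fun i _ => h2 i, Finset.prod_ite]
  simp only [Finset.prod_const_one, one_mul, Finset.prod_const]
  rw [← pow_add]
  congr 1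
  rw [add_comm, ← Finset.card_univ (α := ι),
    ← Finset.card_filter_add_card_filter_not (s := Finset.univ) (fun i => i ∈ P),
    Finset.filter_mem_eq_inter, Finset.univ_inter]

open Classical in
/-- A set of functions all of which agree on `P` lies in a cylinder. -/
theorem card_mul_le_of_agree {ι α : Type*} [Fintype ι] [Fintype α] (P : Finset ι)
    (A : Finset (ι → α)) (h : ∀ x ∈ A, ∀ y ∈ A, ∀ p ∈ P, x p = y p) :
    A.card * Fintype.card α ^ P.card ≤ Fintype.card α ^ Fintype.card ι := by
  rcases A.eq_empty_or_nonempty with rfl | ⟨y, hy⟩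
  · simp
  · rw [← card_cylinder P y]
    refine Nat.mul_le_mul_right _ (Finset.card_le_card fun x hx => ?_)
    simpa using h x hx y hy

end Cylinder

end WalkTrace

namespace WalkTrace

/-! ### Sets of times and their maximal runs -/

section Runs

variable {t : ℕ}

/-- The first elements of the maximal runs of consecutive times in `S`. -/
def runStarts (S : Finset (Fin t)) : Finset (Fin t) :=
  S.filter fun s => s.castSucc ∉ S.map (Fin.succEmb t)

/-- The positions visited by the steps taken at the times in `S`. -/
def positions (S : Finset (Fin t)) : Finset (Fin (t + 1)) :=
  S.map Fin.castSuccEmb ∪ S.map (Fin.succEmb t)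

theorem map_sdiff_map (S : Finset (Fin t)) :
    S.map Fin.castSuccEmb \ S.map (Fin.succEmb t) = (runStarts S).map Fin.castSuccEmb := by
  ext p
  simp only [Finset.mem_sdiff, Finset.mem_map, runStarts, Finset.mem_filter]
  constructor
  · rintro ⟨⟨s, hs, rfl⟩, h⟩
    exact ⟨s, ⟨hs, h⟩, rfl⟩
  · rintro ⟨s, ⟨hs, h⟩, rfl⟩
    exact ⟨⟨s, hs, rfl⟩, h⟩

/-- A run of `r` steps visits `r + 1` positions, so each run costs one extra position. -/
theorem card_positions (S : Finset (Fin t)) :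
    (positions S).card = S.card + (runStarts S).card := by
  rw [positions, ← Finset.card_sdiff_add_card, map_sdiff_map, Finset.card_map, Finset.card_map,
    add_comm]

/-- Going back from `s` while the previous time is in `S` ends at a run start `a`; the whole
interval from `a` to `s` lies in `S`, which bounds its length. -/
theorem exists_runStart_le (S : Finset (Fin t)) {s : Fin t} (hs : s ∈ S) :
    ∃ a ∈ runStarts S, a ≤ s ∧ (s : ℕ) < a + S.card := by
  have key : ∀ i : ℕ, ∀ s : Fin t, (s : ℕ) = i → s ∈ S →
      ∃ a ∈ runStarts S, a ≤ s ∧ Finset.Icc a s ⊆ S := by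
    intro i
    induction i with
    | zero =>
      intro s hsi hs
      refine ⟨s, Finset.mem_filter.2 ⟨hs, ?_⟩, le_rfl, by simpa using hs⟩
      simp only [Finset.mem_map, not_exists, not_and]
      intro r _ h
      have := congrArg Fin.val h
      simp at this
      omega
    | succ i ih =>
      intro s hsi hs
      by_cases h : s ∈ runStarts S
      · exact ⟨s, h, le_rfl, by simpa using hs⟩
      · have h' : s.castSucc ∈ S.map (Fin.succEmb t) := by
          by_contra h'
          exact h (Finset.mem_filter.2 ⟨hs, h'⟩)
        obtain ⟨r, hr, hrs⟩ := Finset.mem_map.1 h'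
        have hv : (r : ℕ) + 1 = s := by simpa using congrArg Fin.val hrs
        obtain ⟨a, ha, har, hI⟩ := ih r (by omega) hr
        refine ⟨a, ha, Fin.le_def.2 (by have := Fin.le_def.1 har; omega), fun q hq => ?_⟩
        rw [Finset.mem_Icc, Fin.le_def, Fin.le_def] at hq
        by_cases hqs : q = s
        · rwa [hqs]
        · have : (q : ℕ) ≠ s := fun h => hqs (Fin.ext h)
          exact hI (Finset.mem_Icc.2 ⟨Fin.le_def.2 hq.1, Fin.le_def.2 (by omega)⟩)
  obtain ⟨a, ha, has, hI⟩ := key s s rfl hs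
  refine ⟨a, ha, has, ?_⟩
  have h1 := Finset.card_le_card hI
  rw [Fin.card_Icc] at h1
  omega

/-- The run starts can be chosen in at most `t ^ k` ways, and they leave only boundedly many
candidates for the remaining times. -/
theorem card_filter_runStarts_le (e k : ℕ) :
    (Finset.univ.filter fun S : Finset (Fin t) => S.card = e ∧ (runStarts S).card = k).card ≤
      2 ^ (k * e) * t ^ k := by
  have hmaps : ∀ S ∈ Finset.univ.filter
      fun S : Finset (Fin t) => S.card = e ∧ (runStarts S).card = k,
      runStarts S ∈ Finset.powersetCard k Finset.univ := fun S hS =>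
    Finset.mem_powersetCard.2 ⟨Finset.subset_univ _, (Finset.mem_filter.1 hS).2.2⟩
  refine (Finset.card_le_mul_card_image_of_maps_to hmaps (2 ^ (k * e)) fun A hA => ?_).trans ?_
  -- Every set of `e` times with run starts `A` lies within the intervals of length `e` that begin
  -- at `A`.
  · set U : Finset (Fin t) := A.biUnion fun a =>
      Finset.univ.filter fun s => a ≤ s ∧ (s : ℕ) < a + e with hU
    have hUc : U.card ≤ k * e := by
      rw [← (Finset.mem_powersetCard.1 hA).2]
      refine Finset.card_biUnion_le_card_mul _ _ _ fun a _ => ?_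
      calc _ ≤ (Finset.range e).card := by
            refine Finset.card_le_card_of_injOn (fun s => (s : ℕ) - a) ?_ ?_
            · intro s hs
              have hs := (Finset.mem_filter.1 hs).2
              have h1 := Fin.le_def.1 hs.1
              simp only [Finset.coe_range, Set.mem_Iio]
              omega
            · intro s hs r hr h
              have hs := Fin.le_def.1 (Finset.mem_filter.1 hs).2.1
              have hr := Fin.le_def.1 (Finset.mem_filter.1 hr).2.1
              exact Fin.ext (by simp only at h; omega)
        _ = e := Finset.card_range e
    calc _ ≤ U.powerset.card := by
          refine Finset.card_le_card fun S hS => ?_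
          simp only [Finset.mem_filter, Finset.mem_univ, true_and] at hS
          obtain ⟨⟨he, -⟩, rfl⟩ := hS
          refine Finset.mem_powerset.2 fun s hs => ?_
          obtain ⟨a, ha, h1, h2⟩ := exists_runStart_le S hs
          exact Finset.mem_biUnion.2 ⟨a, ha, by simp [h1, ← he, h2]⟩
      _ = 2 ^ U.card := Finset.card_powerset U
      _ ≤ 2 ^ (k * e) := Nat.pow_le_pow_right (by norm_num) hUc
  · refine Nat.mul_le_mul_left _ ?_
    rw [Finset.card_powersetCard, Finset.card_univ, Fintype.card_fin]
    exact Nat.choose_le_pow t k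

end Runs

/-! ### Odd degrees force many runs -/

section Parity

/-- The steps at the times in `S` traverse every edge of `T` exactly once. -/
structure TracesEdges {V : Type*} {t : ℕ} (T : SimpleGraph V) (S : Finset (Fin t))
    (l : Fin (t + 1) → V) : Prop where
  adj : ∀ s ∈ S, T.Adj (l s.castSucc) (l s.succ)
  inj : ∀ s ∈ S, ∀ r ∈ S, s(l s.castSucc, l s.succ) = s(l r.castSucc, l r.succ) → s = r
  cover : ∀ e ∈ T.edgeSet, ∃ s ∈ S, s(l s.castSucc, l s.succ) = e

-- Edges at `v` correspond to steps having `v` as an end. A step cannot both leave and enter `v`, so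
-- the degree is departures plus arrivals.
open Classical in
theorem TracesEdges.ncard_neighborSet {V : Type*} [Fintype V] {t : ℕ} {T : SimpleGraph V}
    {S : Finset (Fin t)} {l : Fin (t + 1) → V} (h : TracesEdges T S l) (v : V) :
    (T.neighborSet v).ncard = ((S.map Fin.castSuccEmb).filter fun p => l p = v).card +
      ((S.map (Fin.succEmb t)).filter fun p => l p = v).card := by
  have h1 : (T.neighborSet v).ncard = (T.incidenceFinset v).card := by
    rw [SimpleGraph.card_incidenceFinset_eq_degree, Set.ncard_eq_toFinset_card']
    rfl
  have h2 : (T.incidenceFinset v).card =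
      (S.filter fun s => v ∈ s(l s.castSucc, l s.succ)).card := by
    symm
    refine Finset.card_nbij (fun s => s(l s.castSucc, l s.succ)) ?_ ?_ ?_
    · intro s hs
      have hs := Finset.mem_filter.1 hs
      refine Finset.mem_coe.2 ((SimpleGraph.mem_incidenceFinset _ _ _).2 ?_)
      exact ⟨h.adj s hs.1, hs.2⟩
    · intro s hs r hr hsr
      exact h.inj s (Finset.mem_filter.1 hs).1 r (Finset.mem_filter.1 hr).1 hsr
    · intro e he
      have he : e ∈ T.incidenceSet v := by simpa using he
      obtain ⟨s, hs, rfl⟩ := h.cover e he.1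
      exact ⟨s, Finset.mem_coe.2 (Finset.mem_filter.2 ⟨hs, he.2⟩), rfl⟩
  have h3 : (S.filter fun s => v ∈ s(l s.castSucc, l s.succ)) =
      (S.filter fun s => l s.castSucc = v) ∪ S.filter fun s => l s.succ = v := by
    ext s
    simp only [Finset.mem_filter, Finset.mem_union, Sym2.mem_iff, ← and_or_left, eq_comm]
  have h4 : Disjoint (S.filter fun s => l s.castSucc = v) (S.filter fun s => l s.succ = v) := by
    refine Finset.disjoint_left.2 fun s hs hs' => ?_
    rw [Finset.mem_filter] at hs hs'
    exact (h.adj s hs.1).ne (hs.2.trans hs'.2.symm)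
  rw [h1, h2, h3, Finset.card_union_of_disjoint h4, Finset.filter_map, Finset.filter_map,
    Finset.card_map, Finset.card_map]
  rfl

/-- A position inside a run is both a departure and an arrival and contributes two to a degree.
Hence an odd vertex must occupy the first or last position of a run. -/
theorem TracesEdges.oddCount_le {V : Type*} [Fintype V] {t : ℕ} {T : SimpleGraph V}
    {S : Finset (Fin t)} {l : Fin (t + 1) → V} (h : TracesEdges T S l) :
    oddCount T ≤ 2 * (runStarts S).card := by
  classical
  set A := S.map Fin.castSuccEmb with hA
  set B := S.map (Fin.succEmb t) with hB
  -- `A` holds the departure positions and `B` the arrival positions. A vertex absent from their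
  -- symmetric difference has as many departures as arrivals, hence even degree.
  have hsub : {v : V | Odd (T.neighborSet v).ncard} ⊆ (((A \ B) ∪ (B \ A)).image l : Finset V) := by
    intro v hv
    by_contra hcon
    have heq : (A.filter fun p => l p = v) = B.filter fun p => l p = v := by
      ext p
      simp only [Finset.mem_filter, and_congr_left_iff]
      intro hp
      by_contra hne
      refine hcon ?_
      rw [Finset.mem_coe, Finset.mem_image]
      refine ⟨p, ?_, hp⟩
      rw [Finset.mem_union, Finset.mem_sdiff, Finset.mem_sdiff]
      tauto
    have hv : Odd (T.neighborSet v).ncard := hv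
    rw [h.ncard_neighborSet v, heq] at hv
    exact (Nat.not_odd_iff_even.2 ⟨_, rfl⟩) hv
  have hAB : (A \ B).card = (runStarts S).card := by rw [hA, hB, map_sdiff_map, Finset.card_map]
  have hBA : (B \ A).card = (A \ B).card :=
    Finset.card_sdiff_comm (by rw [hA, hB, Finset.card_map, Finset.card_map])
  calc oddCount T ≤ (((A \ B) ∪ (B \ A)).image l).card := by
        rw [oddCount, ← Set.ncard_coe_finset]
        exact Set.ncard_le_ncard hsub (Finset.finite_toSet _)
    _ ≤ ((A \ B) ∪ (B \ A)).card := Finset.card_image_le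
    _ ≤ (A \ B).card + (B \ A).card := Finset.card_union_le _ _
    _ = 2 * (runStarts S).card := by rw [hBA, hAB, two_mul]

/-- One time is picked for each edge of the copy, and the visited vertices are pulled back to `V`.
Recording `l` and `φ` separately makes a union bound over both possible. -/
theorem exists_tracesEdges {V α : Type*} [Fintype V] [Nonempty V] {t : ℕ} {T : SimpleGraph V}
    {x : Fin (t + 1) → α} (hT : T.IsContained (trace x)) :
    ∃ (S : Finset (Fin t)) (l : Fin (t + 1) → V) (φ : V → α), S.card = Nat.card T.edgeSet ∧
      TracesEdges T S l ∧ ∀ p ∈ positions S, x p = φ (l p) := by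
  classical
  obtain ⟨f⟩ := hT
  have hf : Function.Injective f.toHom := f.injective'
  have hex : ∀ e : T.edgeSet, ∃ s : Fin t, s(x s.castSucc, x s.succ) = Sym2.map f.toHom e := by
    rintro ⟨e, he⟩
    induction e using Sym2.ind with
    | _ a b =>
      have := f.toHom.map_adj he
      obtain ⟨s, hs⟩ := ((SimpleGraph.fromEdgeSet_adj _).1 this).1
      exact ⟨s, hs.symm⟩
  choose τ hτ using hex
  have hτi : Function.Injective τ := fun e e' h =>
    Subtype.ext (Sym2.map.injective hf (by rw [← hτ, ← hτ, h]))
  -- The label `invFun` is arbitrary off the image of `f`, but the chosen steps have both ends in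
  -- that image.
  have hedge : ∀ e, s(Function.invFun f.toHom (x (τ e).castSucc),
      Function.invFun f.toHom (x (τ e).succ)) = (e : Sym2 V) := by
    intro e
    rw [← Sym2.map_mk, hτ, Sym2.map_map, Function.invFun_comp hf, Sym2.map_id]
    rfl
  refine ⟨Finset.univ.image τ, fun p => Function.invFun f.toHom (x p), f.toHom, ?_, ⟨?_, ?_, ?_⟩,
    ?_⟩
  · rw [Finset.card_image_of_injective _ hτi, Finset.card_univ, Nat.card_eq_fintype_card]
  · intro s hs
    obtain ⟨e, -, rfl⟩ := Finset.mem_image.1 hs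
    rw [← SimpleGraph.mem_edgeSet, hedge]
    exact e.2
  · intro s hs r hr h
    obtain ⟨e, -, rfl⟩ := Finset.mem_image.1 hs
    obtain ⟨e', -, rfl⟩ := Finset.mem_image.1 hr
    rw [hedge, hedge] at h
    rw [Subtype.ext h]
  · intro e he
    exact ⟨τ ⟨e, he⟩, Finset.mem_image_of_mem _ (Finset.mem_univ _), hedge ⟨e, he⟩⟩
  · intro p hp
    have hmem : ∀ e : T.edgeSet, ∀ y, y ∈ s(x (τ e).castSucc, x (τ e).succ) →
        ∃ a, f.toHom a = y := by
      intro e y hy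
      rw [hτ, Sym2.mem_map] at hy
      obtain ⟨a, -, ha⟩ := hy
      exact ⟨a, ha⟩
    symm
    apply Function.invFun_eq
    rcases Finset.mem_union.1 hp with hp | hp <;> obtain ⟨s, hs, rfl⟩ := Finset.mem_map.1 hp <;>
      obtain ⟨e, -, rfl⟩ := Finset.mem_image.1 hs
    · exact hmem e _ (Sym2.mem_mk_left _ _)
    · exact hmem e _ (Sym2.mem_mk_right _ _)

end Parity

/-! ### First moment bound for a connected graph -/

section FirstMoment

open Classical in
/-- The trajectories that follow, at the positions `P`, some vertex map defined on `V`. -/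
theorem card_factor_mul_le {ι V α : Type*} [Fintype ι] [Fintype V] [Fintype α] (P : Finset ι)
    (A : Finset (ι → α)) (hA : ∀ x ∈ A, ∃ (l : ι → V) (φ : V → α), ∀ p ∈ P, x p = φ (l p)) :
    A.card * Fintype.card α ^ P.card ≤
      Fintype.card V ^ P.card * Fintype.card α ^ Fintype.card V *
        Fintype.card α ^ Fintype.card ι := by
  set B : (P → V) × (V → α) → Finset (ι → α) := fun q =>
    Finset.univ.filter fun x => ∀ p : P, x p = q.2 (q.1 p) with hB
  have hsub : A ⊆ Finset.univ.biUnion B := by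
    intro x hx
    obtain ⟨l, φ, h⟩ := hA x hx
    refine Finset.mem_biUnion.2 ⟨(fun p => l p, φ), Finset.mem_univ _, ?_⟩
    exact Finset.mem_filter.2 ⟨Finset.mem_univ _, fun p => h p p.2⟩
  calc _ ≤ (∑ q, (B q).card) * Fintype.card α ^ P.card :=
        Nat.mul_le_mul_right _ ((Finset.card_le_card hsub).trans Finset.card_biUnion_le)
    _ = ∑ q, (B q).card * Fintype.card α ^ P.card := Finset.sum_mul _ _ _
    _ ≤ ∑ _q : (P → V) × (V → α), Fintype.card α ^ Fintype.card ι := by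
        refine Finset.sum_le_sum fun q _ => card_mul_le_of_agree P _ fun x hx y hy p hp => ?_
        exact ((Finset.mem_filter.1 hx).2 ⟨p, hp⟩).trans ((Finset.mem_filter.1 hy).2 ⟨p, hp⟩).symm
    _ = _ := by
        rw [Finset.sum_const, Finset.card_univ, Fintype.card_prod, Fintype.card_fun,
          Fintype.card_fun, Fintype.card_coe, smul_eq_mul]

-- Union bound over the number of runs `k`, the set of times, the labels and the vertex map. The `e
-- + k` prescribed positions against at most `e + 1` free images leave `n ^ (1 - k)`, and `t ^ k`
-- comes from the choice of times.
open Classical in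
theorem card_isContained_le {V α : Type*} [Fintype V] [Fintype α] [Nonempty α]
    {T : SimpleGraph V} (hT : T.Connected) (t e : ℕ) (he : Nat.card T.edgeSet = e) :
    ((Finset.univ.filter fun x : Fin (t + 1) → α => T.IsContained (trace x)).card : ℝ) /
        (Fintype.card α : ℝ) ^ (t + 1) ≤
      ∑ k ∈ (Finset.range (e + 1)).filter fun k => oddCount T ≤ 2 * k,
        (2 ^ (e * e) * (e + 1) ^ (2 * e) : ℝ) *
          (Fintype.card α * ((t : ℝ) / Fintype.card α) ^ k) := by
  have := hT.nonempty
  set n := Fintype.card α with hn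
  have hn0 : 0 < n := Fintype.card_pos
  have hnR : (0 : ℝ) < n := by exact_mod_cast hn0
  have hV : Fintype.card V ≤ e + 1 := by
    rw [← he, ← Nat.card_eq_fintype_card]
    exact hT.card_vert_le_card_edgeSet_add_one
  set B : Finset (Fin t) → Finset (Fin (t + 1) → α) := fun S =>
    Finset.univ.filter fun x => ∃ (l : Fin (t + 1) → V) (φ : V → α),
      ∀ p ∈ positions S, x p = φ (l p) with hB
  set 𝒮 : ℕ → Finset (Finset (Fin t)) := fun k =>
    Finset.univ.filter fun S => S.card = e ∧ (runStarts S).card = k with h𝒮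
  set R := (Finset.range (e + 1)).filter fun k => oddCount T ≤ 2 * k with hR
  have hsub : (Finset.univ.filter fun x : Fin (t + 1) → α => T.IsContained (trace x)) ⊆
      R.biUnion fun k => (𝒮 k).biUnion B := by
    intro x hx
    obtain ⟨S, l, φ, hS, htr, hx⟩ := exists_tracesEdges (Finset.mem_filter.1 hx).2
    have hle : (runStarts S).card ≤ S.card := Finset.card_filter_le _ _
    refine Finset.mem_biUnion.2 ⟨(runStarts S).card, ?_, Finset.mem_biUnion.2 ⟨S, ?_, ?_⟩⟩
    · exact Finset.mem_filter.2 ⟨Finset.mem_range.2 (by omega), htr.oddCount_le⟩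
    · exact Finset.mem_filter.2 ⟨Finset.mem_univ _, by omega, rfl⟩
    · exact Finset.mem_filter.2 ⟨Finset.mem_univ _, l, φ, hx⟩
  have hBS : ∀ k ∈ R, ∀ S ∈ 𝒮 k, ((B S).card : ℝ) ≤
      (e + 1) ^ (2 * e) * (n / n ^ k) * n ^ (t + 1) := by
    intro k hk S hS
    obtain ⟨hSe, hSk⟩ := (Finset.mem_filter.1 hS).2
    have hke : k ≤ e := by have := Finset.mem_range.1 (Finset.mem_filter.1 hk).1; omega
    have h1 := card_factor_mul_le (V := V) (α := α) (positions S) (B S)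
      fun x hx => (Finset.mem_filter.1 hx).2
    rw [card_positions, hSe, hSk, Fintype.card_fin, ← hn] at h1
    have h2 : (B S).card * n ^ (e + k) ≤ (e + 1) ^ (2 * e) * n ^ (e + 1) * n ^ (t + 1) := by
      refine h1.trans (Nat.mul_le_mul_right _ (Nat.mul_le_mul ?_ ?_))
      · exact (Nat.pow_le_pow_left hV _).trans (Nat.pow_le_pow_right (by omega) (by omega))
      · exact Nat.pow_le_pow_right hn0 hV
    have h3 : ((B S).card : ℝ) * (n : ℝ) ^ (e + k) ≤
        (e + 1) ^ (2 * e) * (n : ℝ) ^ (e + 1) * n ^ (t + 1) := by exact_mod_cast h2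
    rw [← mul_le_mul_iff_left₀ (pow_pos hnR (e + k))]
    refine h3.trans_eq ?_
    have : (n : ℝ) ^ k ≠ 0 := by positivity
    field_simp
    ring
  have hcard : ((Finset.univ.filter fun x : Fin (t + 1) → α => T.IsContained (trace x)).card : ℝ) ≤
      ∑ k ∈ R, ∑ S ∈ 𝒮 k, ((B S).card : ℝ) := by
    have h1 : (Finset.univ.filter fun x : Fin (t + 1) → α => T.IsContained (trace x)).card ≤
        ∑ k ∈ R, ∑ S ∈ 𝒮 k, (B S).card :=
      (Finset.card_le_card hsub).trans (Finset.card_biUnion_le.trans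
        (Finset.sum_le_sum fun k _ => Finset.card_biUnion_le))
    exact_mod_cast h1
  rw [div_le_iff₀ (by positivity), Finset.sum_mul]
  refine hcard.trans (Finset.sum_le_sum fun k hk => ?_)
  have hke : k ≤ e := by have := Finset.mem_range.1 (Finset.mem_filter.1 hk).1; omega
  have hc : ((𝒮 k).card : ℝ) ≤ 2 ^ (e * e) * (t : ℝ) ^ k := by
    have h1 : (𝒮 k).card ≤ 2 ^ (e * e) * t ^ k := (card_filter_runStarts_le e k).trans
      (Nat.mul_le_mul_right _ (Nat.pow_le_pow_right (by norm_num) (Nat.mul_le_mul_right _ hke)))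
    exact_mod_cast h1
  calc ∑ S ∈ 𝒮 k, ((B S).card : ℝ)
      ≤ (𝒮 k).card • ((e + 1) ^ (2 * e) * (n / n ^ k) * n ^ (t + 1) : ℝ) :=
        Finset.sum_le_card_nsmul _ _ _ (hBS k hk)
    _ ≤ (2 ^ (e * e) * (t : ℝ) ^ k) * ((e + 1) ^ (2 * e) * (n / n ^ k) * n ^ (t + 1) : ℝ) := by
        rw [nsmul_eq_mul]
        exact mul_le_mul_of_nonneg_right hc (by positivity)
    _ = _ := by rw [div_pow]; ring

open Classical in
/-- First moment bound: a connected graph with `θ` odd vertices is unlikely to be contained in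
the trace of a short walk. -/
theorem card_isContained_le_rpow {V α : Type*} [Fintype V] [Fintype α] [Nonempty α]
    {T : SimpleGraph V} (hT : T.Connected) (t : ℕ) (ht : t ≤ Fintype.card α) (h0 : oddCount T ≠ 0) :
    ((Finset.univ.filter fun x : Fin (t + 1) → α => T.IsContained (trace x)).card : ℝ) /
        (Fintype.card α : ℝ) ^ (t + 1) ≤
      ((Nat.card T.edgeSet + 1) * (2 ^ (Nat.card T.edgeSet * Nat.card T.edgeSet) *
        (Nat.card T.edgeSet + 1) ^ (2 * Nat.card T.edgeSet)) : ℝ) *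
      ((t : ℝ) / (Fintype.card α : ℝ) ^ (1 - 2 / (oddCount T : ℝ))) ^ ((oddCount T : ℝ) / 2) := by
  set n := Fintype.card α with hn
  set e := Nat.card T.edgeSet with he
  set θ := oddCount T with hθ
  have hn0 : 0 < n := Fintype.card_pos
  have hnR : (0 : ℝ) < n := by exact_mod_cast hn0
  have hθ0 : (0 : ℝ) < θ := by exact_mod_cast Nat.pos_of_ne_zero h0
  have hx0 : (0 : ℝ) ≤ (t : ℝ) / n := by positivity
  have hx1 : (t : ℝ) / n ≤ 1 := div_le_one_of_le₀ (by exact_mod_cast ht) hnR.le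
  -- This identity is where the threshold exponent comes from: it solves `n (t/n) ^ (θ/2) = 1` for
  -- `t`.
  have hval : ((t : ℝ) / (n : ℝ) ^ (1 - 2 / (θ : ℝ))) ^ ((θ : ℝ) / 2) =
      n * ((t : ℝ) / n) ^ ((θ : ℝ) / 2) := by
    rw [Real.div_rpow (by positivity) (by positivity), ← Real.rpow_mul hnR.le,
      Real.div_rpow (by positivity) hnR.le,
      show (1 - 2 / (θ : ℝ)) * (θ / 2) = θ / 2 - 1 by field_simp, Real.rpow_sub_one hnR.ne']
    field_simp
  rw [hval]
  have h1 := card_isContained_le (α := α) hT t e he.symm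
  rw [← hn] at h1
  refine h1.trans ((Finset.sum_le_card_nsmul _ _
    ((2 ^ (e * e) * (e + 1) ^ (2 * e) : ℝ) * (n * ((t : ℝ) / n) ^ ((θ : ℝ) / 2)))
    fun k hk => ?_).trans ?_)
  · refine mul_le_mul_of_nonneg_left (mul_le_mul_of_nonneg_left ?_ hnR.le) (by positivity)
    rw [← Real.rpow_natCast]
    -- As `t / n ≤ 1` and `k ≥ θ / 2`, lowering the exponent to `θ / 2` only increases the power.
    refine Real.rpow_le_rpow_of_exponent_ge' hx0 hx1 (by positivity) ?_
    · have : θ ≤ 2 * k := (Finset.mem_filter.1 hk).2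
      have : (θ : ℝ) ≤ 2 * k := by exact_mod_cast this
      linarith
  · rw [nsmul_eq_mul, mul_assoc ((e : ℝ) + 1)]
    refine mul_le_mul_of_nonneg_right ?_ (by positivity)
    have h2 := Finset.card_filter_le (Finset.range (e + 1)) fun k => θ ≤ 2 * k
    rw [Finset.card_range] at h2
    exact_mod_cast h2

end FirstMoment

end WalkTrace

namespace WalkTrace

/-! ### Decomposing a forest into trails between odd vertices -/

section Decomposition

/-- The edge-disjoint trails `w j 0, …, w j (len j)` cover the edges of `H`, and their end vertices
are distinct vertices of odd degree. -/
structure IsTrailDecomposition {ι W : Type*} (H : SimpleGraph W) (len : ι → ℕ)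
    (w : ι → ℕ → W) : Prop where
  len_pos : ∀ j, 0 < len j
  adj : ∀ j, ∀ i < len j, H.Adj (w j i) (w j (i + 1))
  inj : ∀ j, ∀ i < len j, ∀ j', ∀ i' < len j',
    s(w j i, w j (i + 1)) = s(w j' i', w j' (i' + 1)) → j = j' ∧ i = i'
  cover : ∀ a b, H.Adj a b → ∃ j, ∃ i < len j, s(w j i, w j (i + 1)) = s(a, b)
  odd_start : ∀ j, Odd (H.neighborSet (w j 0)).ncard
  odd_end : ∀ j, Odd (H.neighborSet (w j (len j))).ncard
  start_inj : ∀ j j', w j 0 = w j' 0 → j = j'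
  end_inj : ∀ j j', w j (len j) = w j' (len j') → j = j'
  start_ne_end : ∀ j j', w j 0 ≠ w j' (len j')

variable {W : Type*}

open SimpleGraph

/-- The end of a longest path in a forest is a leaf. -/
theorem neighborSet_end_of_longest {H : SimpleGraph W} (hH : H.IsAcyclic) {u v : W}
    {p : H.Walk u v} (hp : p.IsPath) (hnil : ¬ p.Nil)
    (hmax : ∀ (y : W) (q : H.Walk u y), q.IsPath → q.length ≤ p.length) :
    H.neighborSet v = {p.penultimate} := by
  ext x
  rw [mem_neighborSet, Set.mem_singleton_iff]
  constructor
  · intro hx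
    by_cases hs : x ∈ p.support
    · exact hH.eq_penultimate_of_adj_end hp hx hs
    · have := hmax x _ (hp.concat hs hx)
      rw [Walk.length_concat] at this
      omega
  · rintro rfl
    exact (p.adj_penultimate hnil).symm

theorem exists_longest_path [Finite W] {H : SimpleGraph W} (hne : H ≠ ⊥) :
    ∃ (u v : W) (p : H.Walk u v), p.IsPath ∧ ¬ p.Nil ∧
      ∀ (a b : W) (q : H.Walk a b), q.IsPath → q.length ≤ p.length := by
  have := Fintype.ofFinite W
  obtain ⟨a, b, hab⟩ := ne_bot_iff_exists_adj.1 hne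
  set L : Set ℕ := {k | ∃ (u v : W) (p : H.Walk u v), p.IsPath ∧ p.length = k} with hL
  have hbdd : BddAbove L := by
    refine ⟨Fintype.card W, ?_⟩
    rintro k ⟨u, v, p, hp, rfl⟩
    exact hp.length_lt.le
  have h1 : 1 ∈ L := ⟨a, b, hab.toWalk, Walk.IsPath.of_adj hab, rfl⟩
  obtain ⟨u, v, p, hp, hlen⟩ := Nat.sSup_mem ⟨1, h1⟩ hbdd
  refine ⟨u, v, p, hp, ?_, fun a b q hq => ?_⟩
  · rw [Walk.not_nil_iff_lt_length, hlen]
    exact le_csSup hbdd h1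
  · rw [hlen]
    exact le_csSup hbdd ⟨a, b, q, hq, rfl⟩

theorem ncard_neighborSet_eq_add [Finite W] {H : SimpleGraph W} {u v : W} (p : H.Walk u v)
    (x : W) : (H.neighborSet x).ncard =
      ((H.deleteEdges {e | e ∈ p.edges}).neighborSet x).ncard +
        (p.toSubgraph.neighborSet x).ncard := by
  have hmem : ∀ y, y ∈ p.toSubgraph.neighborSet x ↔ s(x, y) ∈ p.edges := fun y => by
    rw [← p.mem_edges_toSubgraph]
    rfl
  rw [← Set.ncard_union_eq _ (Set.toFinite _) (Set.toFinite _)]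
  · congr 1
    ext y
    rw [Set.mem_union, hmem, mem_neighborSet, mem_neighborSet, deleteEdges_adj]
    have : s(x, y) ∈ p.edges → H.Adj x y := fun h => p.edges_subset_edgeSet h
    simp only [Set.mem_ofPred_eq]
    tauto
  · refine Set.disjoint_left.2 fun y hy hy' => ?_
    rw [mem_neighborSet, deleteEdges_adj] at hy
    exact hy.2 ((hmem y).1 hy')

theorem even_ncard_neighborSet_toSubgraph {H : SimpleGraph W} {u v x : W} {p : H.Walk u v}
    (hp : p.IsPath) (hu : x ≠ u) (hv : x ≠ v) : Even (p.toSubgraph.neighborSet x).ncard := by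
  by_cases hx : x ∈ p.support
  · obtain ⟨i, rfl, hi⟩ := Walk.mem_support_iff_exists_getVert.1 hx
    rw [hp.ncard_neighborSet_toSubgraph_internal_eq_two]
    · exact even_two
    · rintro rfl
      exact hu p.getVert_zero
    · refine lt_of_le_of_ne hi ?_
      rintro rfl
      exact hv p.getVert_length
  · have : p.toSubgraph.neighborSet x = ∅ := by
      refine Set.eq_empty_of_forall_notMem fun y hy => hx ?_
      exact Walk.mem_support_of_adj_toSubgraph hy
    rw [this, Set.ncard_empty]
    exact Even.zero

theorem getVert_edge_inj {H : SimpleGraph W} {u v : W} {p : H.Walk u v} (hp : p.IsPath) {i i' : ℕ}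
    (hi : i < p.length) (hi' : i' < p.length)
    (h : s(p.getVert i, p.getVert (i + 1)) = s(p.getVert i', p.getVert (i' + 1))) : i = i' := by
  have key : ∀ a b, a ≤ p.length → b ≤ p.length → p.getVert a = p.getVert b → a = b :=
    fun a b ha hb hab => hp.getVert_injOn ha hb hab
  rcases Sym2.eq_iff.1 h with ⟨h1, -⟩ | ⟨h1, h2⟩
  · exact key _ _ hi.le hi'.le h1
  · have := key _ _ hi.le hi' h1
    have := key _ _ hi hi'.le h2
    omega

/-- The edges of a finite forest decompose into trails between distinct vertices of odd degree. -/
theorem exists_isTrailDecomposition [Finite W] (H : SimpleGraph W) (hH : H.IsAcyclic) :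
    ∃ (ι : Type) (_ : Fintype ι) (len : ι → ℕ) (w : ι → ℕ → W), IsTrailDecomposition H len w := by
  induction hm : H.edgeSet.ncard using Nat.strong_induction_on generalizing H with
  | _ m ih =>
  by_cases hbot : H = ⊥
  · subst hbot
    exact ⟨Empty, inferInstance, fun _ => 0, fun j => j.elim, ⟨nofun, nofun, nofun,
      fun a b h => h.elim, nofun, nofun, nofun, nofun, nofun⟩⟩
  -- A longest path joins two leaves. Deleting its edges isolates both ends and changes every other
  -- degree by an even number, so later trails can end neither at `u` nor at `v`, and their ends are
  -- still odd in `H`.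
  obtain ⟨u, v, p, hp, hnil, hmax⟩ := exists_longest_path hbot
  set H' := H.deleteEdges {e | e ∈ p.edges} with hH'
  have hle : H' ≤ H := deleteEdges_le _
  have hedge : s(p.penultimate, v) ∈ p.edges := Walk.mk_penultimate_end_mem_edges hnil
  have hcard : H'.edgeSet.ncard < m := by
    rw [← hm]
    refine Set.ncard_lt_ncard ⟨edgeSet_mono hle, fun h => ?_⟩ (Set.toFinite _)
    have h1 : H'.Adj p.penultimate v := h (p.edges_subset_edgeSet hedge)
    exact (deleteEdges_adj.1 h1).2 hedge
  have hlenpos : 0 < p.length := Walk.not_nil_iff_lt_length.1 hnil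
  have huv : u ≠ v := fun h => hnil (hp.nil_iff_eq.2 h)
  have hNv : H.neighborSet v = {p.penultimate} :=
    neighborSet_end_of_longest hH hp hnil fun y q hq => hmax u y q hq
  have hNu : H.neighborSet u = {p.reverse.penultimate} :=
    neighborSet_end_of_longest hH hp.reverse (by simpa using hnil)
      fun y q hq => by simpa using hmax v y q hq
  have hedge' : s(p.reverse.penultimate, u) ∈ p.edges := by
    have := Walk.mk_penultimate_end_mem_edges (p := p.reverse) (by simpa using hnil)
    simpa using this
  have hiso : ∀ x y, H.neighborSet x = {y} → s(y, x) ∈ p.edges → (H'.neighborSet x).ncard = 0 := by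
    intro x y hxy he
    have : H'.neighborSet x = ∅ := by
      refine Set.eq_empty_of_forall_notMem fun z hz => ?_
      have hz' : z ∈ H.neighborSet x := hle hz
      rw [hxy, Set.mem_singleton_iff] at hz'
      subst hz'
      rw [Sym2.eq_swap] at he
      exact (deleteEdges_adj.1 hz).2 he
    rw [this, Set.ncard_empty]
  have hv0 := hiso v _ hNv hedge
  have hu0 := hiso u _ hNu hedge'
  have hodd : ∀ x, Odd (H'.neighborSet x).ncard →
      x ≠ u ∧ x ≠ v ∧ Odd (H.neighborSet x).ncard := by
    intro x hx
    have hxu : x ≠ u := by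
      rintro rfl
      rw [hu0] at hx
      exact absurd hx (by decide)
    have hxv : x ≠ v := by
      rintro rfl
      rw [hv0] at hx
      exact absurd hx (by decide)
    refine ⟨hxu, hxv, ?_⟩
    rw [ncard_neighborSet_eq_add p x]
    exact hx.add_even (even_ncard_neighborSet_toSubgraph hp hxu hxv)
  obtain ⟨ι, hι, len, w, hd⟩ := ih _ hcard H' (hH.anti hle) rfl
  have hmem : ∀ i < p.length, s(p.getVert i, p.getVert (i + 1)) ∈ p.edges := fun i hi =>
    p.mk_mem_edges_iff_exists.2 ⟨i, hi, rfl⟩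
  have hnmem : ∀ j, ∀ i < len j, s(w j i, w j (i + 1)) ∉ p.edges := fun j i hi =>
    (deleteEdges_adj.1 (hd.adj j i hi)).2
  have hu1 : Odd (H.neighborSet u).ncard := by rw [hNu, Set.ncard_singleton]; exact odd_one
  have hv1 : Odd (H.neighborSet v).ncard := by rw [hNv, Set.ncard_singleton]; exact odd_one
  refine ⟨Option ι, inferInstance, fun j => j.elim p.length len,
    fun j => j.elim p.getVert w, ⟨?_, ?_, ?_, ?_, ?_, ?_, ?_, ?_, ?_⟩⟩
  · rintro (_ | j)
    exacts [hlenpos, hd.len_pos j]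
  · rintro (_ | j) i hi
    exacts [p.adj_getVert_succ hi, hle (hd.adj j i hi)]
  · rintro (_ | j) i hi (_ | j') i' hi' h
    · exact ⟨rfl, getVert_edge_inj hp hi hi' h⟩
    · exact absurd (h ▸ hmem i hi) (hnmem j' i' hi')
    · exact absurd (h ▸ hmem i' hi') (hnmem j i hi)
    · obtain ⟨h1, h2⟩ := hd.inj j i hi j' i' hi' h
      exact ⟨congrArg some h1, h2⟩
  · intro a b hab
    by_cases h : s(a, b) ∈ p.edges
    · obtain ⟨i, hi, h⟩ := p.mk_mem_edges_iff_exists.1 h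
      exact ⟨none, i, hi, h⟩
    · obtain ⟨j, i, hi, h⟩ := hd.cover a b (deleteEdges_adj.2 ⟨hab, h⟩)
      exact ⟨some j, i, hi, h⟩
  · rintro (_ | j)
    · simpa using hu1
    · exact (hodd _ (hd.odd_start j)).2.2
  · rintro (_ | j)
    · simpa using hv1
    · exact (hodd _ (hd.odd_end j)).2.2
  · rintro (_ | j) (_ | j') h
    · rfl
    · exact absurd (h.symm.trans p.getVert_zero) (hodd _ (hd.odd_start j')).1
    · exact absurd (h.trans p.getVert_zero) (hodd _ (hd.odd_start j)).1
    · exact congrArg some (hd.start_inj j j' h)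
  · rintro (_ | j) (_ | j') h
    · rfl
    · exact absurd (h.symm.trans p.getVert_length) (hodd _ (hd.odd_end j')).2.1
    · exact absurd (h.trans p.getVert_length) (hodd _ (hd.odd_end j)).2.1
    · exact congrArg some (hd.end_inj j j' h)
  · rintro (_ | j) (_ | j') h
    · exact huv (p.getVert_zero.symm.trans (h.trans p.getVert_length))
    · exact (hodd _ (hd.odd_end j')).1 (h.symm.trans p.getVert_zero)
    · exact (hodd _ (hd.odd_start j)).2.1 (h.trans p.getVert_length)
    · exact hd.start_ne_end j j' h

end Decomposition

/-! ### Vertices, edges and components in a forest -/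

section Forest

variable {W : Type*}

open SimpleGraph

/-- In a forest a vertex has at most one neighbour closer to a given root. -/
theorem parent_unique {F : SimpleGraph W} (hF : F.IsAcyclic) {r a b v : W} (ha : F.Adj a v)
    (hb : F.Adj b v) (hr : F.Reachable r v) (hda : F.dist r a < F.dist r v)
    (hdb : F.dist r b < F.dist r v) : a = b := by
  obtain ⟨p, hp, -⟩ := hr.exists_path_of_dist
  have key : ∀ c, F.Adj c v → F.dist r c < F.dist r v → c = p.penultimate := by
    intro c hc hd
    obtain ⟨q, hq, hql⟩ := (hr.trans hc.symm.reachable).exists_path_of_dist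
    have hv : v ∉ q.support := by
      intro hv
      classical
      have h1 := dist_le (q.takeUntil v hv)
      have h2 := q.length_takeUntil_le_length hv
      omega
    exact hF.eq_penultimate_of_adj_end hp hc.symm
      (hF.mem_support_of_ne_mem_support_of_adj_of_isPath hp hq hc.symm hv)
  rw [key a ha hda, key b hb hdb]

/-- A set `E` of edges of a forest that meets the components in `D` spans at least `|E| + |D|`
vertices. -/
theorem card_add_card_le_of_isAcyclic {F : SimpleGraph W} (hF : F.IsAcyclic)
    (E : Finset (Sym2 W)) (hE : ∀ e ∈ E, e ∈ F.edgeSet) (U : Finset W)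
    (hU : ∀ e ∈ E, ∀ x ∈ e, x ∈ U) (D : Finset F.ConnectedComponent)
    (hD : ∀ C ∈ D, ∃ x ∈ U, F.connectedComponentMk x = C)
    (hED : ∀ e ∈ E, ∀ x ∈ e, F.connectedComponentMk x ∈ D) : E.card + D.card ≤ U.card := by
  classical
  rcases isEmpty_or_nonempty W with hW | hW
  · have h1 : E = ∅ := Finset.eq_empty_of_forall_notMem fun e _ => e.ind fun a _ => hW.elim a
    have h2 : D = ∅ := Finset.eq_empty_of_forall_notMem fun C _ => C.ind fun a => hW.elim a
    simp [h1, h2]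
  -- Each component in `D` gets a root in `U`, and each edge is charged to its end farther from the
  -- root. Uniqueness of parents makes the charging injective, and no root is charged.
  choose! r hrU hr using hD
  have hchild : ∀ e ∈ E, ∃ v a, e = s(a, v) ∧ F.dist (r (F.connectedComponentMk v)) a <
      F.dist (r (F.connectedComponentMk v)) v := by
    intro e he
    induction e using Sym2.ind with
    | _ a b =>
      have hab : F.Adj a b := hE _ he
      have hC : F.connectedComponentMk a = F.connectedComponentMk b :=
        ConnectedComponent.eq.2 hab.reachable
      have hreach : F.Reachable (r (F.connectedComponentMk a)) a :=
        ConnectedComponent.eq.1 (hr _ (hED _ he a (Sym2.mem_mk_left _ _)))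
      rcases hF.dist_eq_dist_add_one_of_adj_of_reachable _ hab hreach with h | h
      · exact ⟨a, b, Sym2.eq_swap, by omega⟩
      · exact ⟨b, a, rfl, by rw [← hC]; omega⟩
  choose! c a hc hlt using hchild
  have hcmem : ∀ e ∈ E, c e ∈ e := fun e he => by
    have h := Sym2.mem_mk_right (a e) (c e)
    rwa [← hc e he] at h
  have hcinj : Set.InjOn c E := by
    intro e he e' he' h
    have he := Finset.mem_coe.1 he
    have he' := Finset.mem_coe.1 he'
    have h1 : F.Adj (a e) (c e) := by rw [← mem_edgeSet, ← hc e he]; exact hE e he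
    have h2 : F.Adj (a e') (c e') := by rw [← mem_edgeSet, ← hc e' he']; exact hE e' he'
    have hlt' := hlt e' he'
    rw [← h] at h2 hlt'
    have := parent_unique hF h1 h2
      (ConnectedComponent.eq.1 (hr _ (hED e he _ (hcmem e he)))) (hlt e he) hlt'
    rw [hc e he, hc e' he', this, h]
  have hrinj : Set.InjOn r D := fun C hC C' hC' h => by
    rw [← hr C hC, ← hr C' hC', h]
  have hdisj : Disjoint (E.image c) (D.image r) := by
    refine Finset.disjoint_left.2 fun x hx hx' => ?_
    obtain ⟨e, he, rfl⟩ := Finset.mem_image.1 hx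
    obtain ⟨C, hC, hCe⟩ := Finset.mem_image.1 hx'
    have hCC := hr C hC
    have hl := hlt e he
    rw [← hCe, hCC, SimpleGraph.dist_self] at hl
    omega
  rw [← Finset.card_image_of_injOn hcinj, ← Finset.card_image_of_injOn hrinj,
    ← Finset.card_union_of_disjoint hdisj]
  refine Finset.card_le_card (Finset.union_subset ?_ ?_)
  · intro x hx
    obtain ⟨e, he, rfl⟩ := Finset.mem_image.1 hx
    exact hU e he _ (hcmem e he)
  · intro x hx
    obtain ⟨C, hC, rfl⟩ := Finset.mem_image.1 hx
    exact hrU C hC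

theorem ncard_neighborSet_toSimpleGraph {F : SimpleGraph W} (C : F.ConnectedComponent) (v : C) :
    (C.toSimpleGraph.neighborSet v).ncard = (F.neighborSet v).ncard := by
  rw [← Set.ncard_image_of_injective _ Subtype.val_injective]
  congr 1
  ext x
  simp only [Set.mem_image, mem_neighborSet]
  constructor
  · rintro ⟨y, hy, rfl⟩
    exact (C.toSimpleGraph_adj v.2 y.2).1 hy
  · intro hx
    have hxC : x ∈ C := by
      have h1 : F.connectedComponentMk v = C := v.2
      exact (ConnectedComponent.eq.2 hx.symm.reachable).trans h1
    exact ⟨⟨x, hxC⟩, (C.toSimpleGraph_adj v.2 hxC).2 hx, rfl⟩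

theorem oddCount_toSimpleGraph {F : SimpleGraph W} (C : F.ConnectedComponent) :
    oddCount C.toSimpleGraph =
      {v : W | F.connectedComponentMk v = C ∧ Odd (F.neighborSet v).ncard}.ncard := by
  rw [oddCount, ← Set.ncard_image_of_injective _ Subtype.val_injective]
  congr 1
  ext x
  simp only [Set.mem_image, Set.mem_ofPred_eq]
  constructor
  · rintro ⟨y, hy, rfl⟩
    rw [ncard_neighborSet_toSimpleGraph] at hy
    exact ⟨y.2, hy⟩
  · rintro ⟨hC, ho⟩
    exact ⟨⟨x, hC⟩, by rwa [ncard_neighborSet_toSimpleGraph], rfl⟩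

end Forest

/-! ### Families of trails span many vertices -/

section Sparse

variable {ι W : Type*} {F : SimpleGraph W} {len : ι → ℕ} {w : ι → ℕ → W}

open SimpleGraph

theorem IsTrailDecomposition.connectedComponentMk_eq (hd : IsTrailDecomposition F len w) (j : ι)
    {i : ℕ} (hi : i ≤ len j) : F.connectedComponentMk (w j i) = F.connectedComponentMk (w j 0) := by
  induction i with
  | zero => rfl
  | succ i ih =>
    rw [← ih (by omega)]
    exact ConnectedComponent.eq.2 (hd.adj j i hi).symm.reachable

open Classical in
/-- The vertices of the trails indexed by `J`. -/
noncomputable def trailVerts (len : ι → ℕ) (w : ι → ℕ → W) (J : Finset ι) : Finset W :=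
  J.biUnion fun j => (Finset.range (len j + 1)).image (w j)

-- The two ends of each trail are odd vertices of `C`, and all these ends are distinct.
open Classical in
theorem IsTrailDecomposition.two_mul_card_le [Finite W] (hd : IsTrailDecomposition F len w)
    (C : F.ConnectedComponent) (J : Finset ι)
    (hJ : ∀ j ∈ J, F.connectedComponentMk (w j 0) = C) :
    2 * J.card ≤ oddCount C.toSimpleGraph := by
  have hs : (J.image fun j => w j 0).card = J.card :=
    Finset.card_image_of_injective _ fun j j' h => hd.start_inj j j' h
  have he : (J.image fun j => w j (len j)).card = J.card :=
    Finset.card_image_of_injective _ fun j j' h => hd.end_inj j j' h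
  have hdis : Disjoint (J.image fun j => w j 0) (J.image fun j => w j (len j)) := by
    refine Finset.disjoint_left.2 fun x hx hx' => ?_
    obtain ⟨j, -, rfl⟩ := Finset.mem_image.1 hx
    obtain ⟨j', -, h⟩ := Finset.mem_image.1 hx'
    exact hd.start_ne_end j j' h.symm
  calc 2 * J.card = ((J.image fun j => w j 0) ∪ J.image fun j => w j (len j)).card := by
        rw [Finset.card_union_of_disjoint hdis, hs, he, two_mul]
    _ ≤ oddCount C.toSimpleGraph := by
        rw [oddCount_toSimpleGraph, ← Set.ncard_coe_finset]
        refine Set.ncard_le_ncard (fun x hx => ?_) (Set.toFinite _)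
        rcases Finset.mem_union.1 (Finset.mem_coe.1 hx) with hx | hx <;>
          obtain ⟨j, hj, rfl⟩ := Finset.mem_image.1 hx
        · exact ⟨hJ j hj, hd.odd_start j⟩
        · exact ⟨(hd.connectedComponentMk_eq j le_rfl).trans (hJ j hj), hd.odd_end j⟩

/-- Every subfamily of the trails spans many vertices compared to its length. -/
theorem IsTrailDecomposition.sparse [Finite W] (hF : F.IsAcyclic)
    (hd : IsTrailDecomposition F len w) {θ : ℕ}
    (hθ : ∀ C : F.ConnectedComponent, oddCount C.toSimpleGraph ≤ θ) (J : Finset ι) :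
    2 * J.card + θ * ∑ j ∈ J, len j ≤ θ * (trailVerts len w J).card := by
  classical
  set comp : ι → F.ConnectedComponent := fun j => F.connectedComponentMk (w j 0) with hcomp
  set D := J.image comp with hD
  set E : Finset (Sym2 W) :=
    (J.sigma fun j => Finset.range (len j)).image fun q => s(w q.1 q.2, w q.1 (q.2 + 1)) with hE
  have hEc : E.card = ∑ j ∈ J, len j := by
    rw [hE, Finset.card_image_of_injOn, Finset.card_sigma]
    · simp
    · rintro ⟨j, i⟩ hq ⟨j', i'⟩ hq' h
      have hi := (Finset.mem_sigma.1 (Finset.mem_coe.1 hq)).2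
      have hi' := (Finset.mem_sigma.1 (Finset.mem_coe.1 hq')).2
      obtain ⟨rfl, h2⟩ := hd.inj j i (Finset.mem_range.1 hi) j' i' (Finset.mem_range.1 hi') h
      have h2 : i = i' := h2
      rw [h2]
  -- Group the trails by component: each component contains at most `θ / 2` of them.
  have hJD : 2 * J.card ≤ θ * D.card := by
    rw [Finset.card_eq_sum_card_image comp J, ← hD, Finset.mul_sum, mul_comm θ, ← smul_eq_mul]
    refine Finset.sum_le_card_nsmul _ _ _ fun C _ => ?_
    exact (hd.two_mul_card_le C _ fun j hj => (Finset.mem_filter.1 hj).2).trans (hθ C)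
  have hU : ∀ j ∈ J, ∀ i ≤ len j, w j i ∈ trailVerts len w J := fun j hj i hi =>
    Finset.mem_biUnion.2 ⟨j, hj, Finset.mem_image_of_mem _ (Finset.mem_range.2 (by omega))⟩
  have hEx : ∀ e ∈ E, ∀ x ∈ e, ∃ j ∈ J, ∃ i ≤ len j, x = w j i := by
    intro e he x hx
    obtain ⟨⟨j, i⟩, hq, rfl⟩ := Finset.mem_image.1 he
    obtain ⟨hj, hi⟩ := Finset.mem_sigma.1 hq
    have hi := Finset.mem_range.1 hi
    rcases Sym2.mem_iff.1 hx with rfl | rfl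
    · exact ⟨j, hj, i, hi.le, rfl⟩
    · exact ⟨j, hj, i + 1, hi, rfl⟩
  have hmain : E.card + D.card ≤ (trailVerts len w J).card := by
    refine card_add_card_le_of_isAcyclic hF E ?_ _ ?_ D ?_ ?_
    · intro e he
      obtain ⟨⟨j, i⟩, hq, rfl⟩ := Finset.mem_image.1 he
      exact hd.adj j i (Finset.mem_range.1 (Finset.mem_sigma.1 hq).2)
    · intro e he x hx
      obtain ⟨j, hj, i, hi, rfl⟩ := hEx e he x hx
      exact hU j hj i hi
    · intro C hC
      obtain ⟨j, hj, rfl⟩ := Finset.mem_image.1 hC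
      exact ⟨w j 0, hU j hj 0 (Nat.zero_le _), rfl⟩
    · intro e he x hx
      obtain ⟨j, hj, i, hi, rfl⟩ := hEx e he x hx
      rw [hd.connectedComponentMk_eq j hi]
      exact Finset.mem_image_of_mem _ hj
  rw [← hEc]
  nlinarith [Nat.mul_le_mul_left θ hmain]

end Sparse

end WalkTrace

namespace WalkTrace

/-! ### Second moment method over windows and embeddings -/

section SecondMoment

variable {ι W τ α : Type*} {m : ℕ} {len : ι → ℕ} {w : ι → ℕ → W} {pos : ι → Fin m → ℕ → τ}

open Classical in
/-- The positions used in the windows chosen by `b` for the trails indexed by `J`. -/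
noncomputable def windowPositions (pos : ι → Fin m → ℕ → τ) (len : ι → ℕ) (b : ι → Fin m)
    (J : Finset ι) : Finset τ :=
  (J.sigma fun j => Finset.range (len j + 1)).image fun r => pos r.1 (b r.1) r.2

/-- Different windows, and different places in them, have different positions. -/
def SeparatedWindows (pos : ι → Fin m → ℕ → τ) (len : ι → ℕ) : Prop :=
  ∀ j a i j' a' i', i ≤ len j → i' ≤ len j' → pos j a i = pos j' a' i' → j = j' ∧ a = a' ∧ i = i'

theorem mem_windowPositions {b : ι → Fin m} {J : Finset ι} {p : τ} :
    p ∈ windowPositions pos len b J ↔ ∃ j ∈ J, ∃ i ≤ len j, pos j (b j) i = p := by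
  simp only [windowPositions, Finset.mem_image, Finset.mem_sigma, Finset.mem_range, Sigma.exists,
    Nat.lt_succ_iff]
  constructor
  · rintro ⟨j, i, ⟨hj, hi⟩, h⟩
    exact ⟨j, hj, i, hi, h⟩
  · rintro ⟨j, hj, i, hi, h⟩
    exact ⟨j, i, ⟨hj, hi⟩, h⟩

theorem SeparatedWindows.card_windowPositions (hsep : SeparatedWindows pos len) (b : ι → Fin m)
    (J : Finset ι) : (windowPositions pos len b J).card = ∑ j ∈ J, (len j + 1) := by
  classical
  rw [windowPositions, Finset.card_image_of_injOn, Finset.card_sigma]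
  · simp
  · rintro ⟨j, i⟩ hr ⟨j', i'⟩ hr' h
    have hi := Finset.mem_range.1 (Finset.mem_sigma.1 (Finset.mem_coe.1 hr)).2
    have hi' := Finset.mem_range.1 (Finset.mem_sigma.1 (Finset.mem_coe.1 hr')).2
    obtain ⟨rfl, -, h2⟩ := hsep _ _ _ _ _ _ (Nat.lt_succ_iff.1 hi) (Nat.lt_succ_iff.1 hi') h
    have h2 : i = i' := h2
    rw [h2]

open Classical in
/-- The trails for which `b` and `b'` choose the same window. -/
noncomputable def agreeSet [Fintype ι] (b b' : ι → Fin m) : Finset ι :=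
  Finset.univ.filter fun j => b j = b' j

/-- By separation, two choices share positions only in the windows on which they agree. -/
theorem SeparatedWindows.card_union_windowPositions [Fintype ι] [DecidableEq τ]
    (hsep : SeparatedWindows pos len) (b b' : ι → Fin m) :
    2 * ∑ j, (len j + 1) ≤ (windowPositions pos len b Finset.univ ∪
      windowPositions pos len b' Finset.univ).card + ∑ j ∈ agreeSet b b', (len j + 1) := by
  have hsub : windowPositions pos len b Finset.univ ∩ windowPositions pos len b' Finset.univ ⊆
      windowPositions pos len b (agreeSet b b') := by
    intro p hp
    obtain ⟨h1, h2⟩ := Finset.mem_inter.1 hp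
    obtain ⟨j, -, i, hi, rfl⟩ := mem_windowPositions.1 h1
    obtain ⟨j', -, i', hi', h⟩ := mem_windowPositions.1 h2
    obtain ⟨rfl, h2, -⟩ := hsep _ _ _ _ _ _ hi' hi h
    exact mem_windowPositions.2 ⟨j', by simp [agreeSet, h2], i, hi, rfl⟩
  have h1 := Finset.card_le_card hsub
  rw [hsep.card_windowPositions] at h1
  have h2 := Finset.card_union_add_card_inter (windowPositions pos len b Finset.univ)
    (windowPositions pos len b' Finset.univ)
  rw [hsep.card_windowPositions, hsep.card_windowPositions] at h2
  omega

variable [Fintype τ] [Fintype α]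

open Classical in
/-- The trajectories which, in the windows chosen by `b`, follow the trails `w` under `φ`. -/
noncomputable def windowEvent (pos : ι → Fin m → ℕ → τ) (len : ι → ℕ) (w : ι → ℕ → W)
    (q : (ι → Fin m) × (W ↪ α)) : Finset (τ → α) :=
  Finset.univ.filter fun x => ∀ j, ∀ i ≤ len j, x (pos j (q.1 j) i) = q.2 (w j i)

theorem mem_windowEvent {q : (ι → Fin m) × (W ↪ α)} {x : τ → α} :
    x ∈ windowEvent pos len w q ↔ ∀ j, ∀ i ≤ len j, x (pos j (q.1 j) i) = q.2 (w j i) := by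
  simp [windowEvent]

variable [Fintype ι]

theorem card_windowEvent (hsep : SeparatedWindows pos len) [Nonempty α]
    (q : (ι → Fin m) × (W ↪ α)) :
    (windowEvent pos len w q).card * Fintype.card α ^ ∑ j, (len j + 1) =
      Fintype.card α ^ Fintype.card τ := by
  classical
  set g : (Σ j, Fin (len j + 1)) → τ := fun r => pos r.1 (q.1 r.1) r.2 with hg
  have hgi : Function.Injective g := by
    rintro ⟨j, i⟩ ⟨j', i'⟩ h
    obtain ⟨rfl, -, h2⟩ :=
      hsep _ _ _ _ _ _ (Nat.lt_succ_iff.1 i.2) (Nat.lt_succ_iff.1 i'.2) h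
    rw [Fin.ext h2]
  -- Injectivity of `g` keeps the prescriptions from conflicting; the default value is never used at
  -- a window position.
  set f : τ → α := Function.extend g (fun r => q.2 (w r.1 r.2)) fun _ => Classical.arbitrary α
    with hf
  have hfg : ∀ j, ∀ i ≤ len j, f (pos j (q.1 j) i) = q.2 (w j i) := fun j i hi =>
    hgi.extend_apply _ _ (⟨j, ⟨i, Nat.lt_succ_iff.2 hi⟩⟩ : Σ j, Fin (len j + 1))
  rw [← card_cylinder (windowPositions pos len q.1 Finset.univ) f, hsep.card_windowPositions]
  congr 2
  ext x
  simp only [mem_windowEvent, Finset.mem_filter, Finset.mem_univ, true_and, mem_windowPositions]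
  constructor
  · rintro h p ⟨j, i, hi, rfl⟩
    rw [h j i hi, hfg j i hi]
  · intro h j i hi
    rw [h _ ⟨j, i, hi, rfl⟩, hfg j i hi]

variable [Fintype W]

open Classical in
/-- Pairs of embeddings which agree on a given set. -/
theorem card_agree_mul_le (U : Finset W) :
    (Finset.univ.filter fun r : (W ↪ α) × (W ↪ α) => ∀ u ∈ U, r.1 u = r.2 u).card *
      Fintype.card α ^ U.card ≤ Fintype.card α ^ (2 * Fintype.card W) := by
  have h1 : (Finset.univ.filter fun r : (W ↪ α) × (W ↪ α) => ∀ u ∈ U, r.1 u = r.2 u).card ≤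
      ∑ f : W → α, (Finset.univ.filter fun g : W → α => ∀ u ∈ U, g u = f u).card := by
    rw [← Finset.card_sigma]
    refine Finset.card_le_card_of_injOn (fun r => ⟨r.1, r.2⟩) ?_ ?_
    · intro r hr
      have hr := (Finset.mem_filter.1 hr).2
      exact Finset.mem_coe.2 (Finset.mem_sigma.2 ⟨Finset.mem_univ _, Finset.mem_filter.2
        ⟨Finset.mem_univ _, fun u hu => (hr u hu).symm⟩⟩)
    · rintro ⟨f, g⟩ - ⟨f', g'⟩ - h
      simp only [Sigma.mk.injEq, DFunLike.coe_fn_eq, heq_eq_eq] at h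
      rw [h.1, h.2]
  refine (Nat.mul_le_mul_right _ h1).trans_eq ?_
  rw [Finset.sum_mul, Finset.sum_congr rfl fun f _ => card_cylinder U f, Finset.sum_const,
    Finset.card_univ, Fintype.card_fun, smul_eq_mul, two_mul, pow_add]

-- Both events can hold only if the embeddings agree on the vertices `U` of the shared trails, which
-- saves `n ^ |U|` among the pairs. Sharing windows loses one factor `n` per common position.
open Classical in
theorem sum_card_inter_windowEvent_le (hsep : SeparatedWindows pos len) [Nonempty α]
    (b b' : ι → Fin m) :
    (∑ φ : W ↪ α, ∑ φ' : W ↪ α,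
        (windowEvent pos len w (b, φ) ∩ windowEvent pos len w (b', φ')).card) *
      Fintype.card α ^ (trailVerts len w (agreeSet b b')).card *
        Fintype.card α ^ (2 * ∑ j, (len j + 1)) ≤
      Fintype.card α ^ (2 * Fintype.card W) * Fintype.card α ^ Fintype.card τ *
        Fintype.card α ^ ∑ j ∈ agreeSet b b', (len j + 1) := by
  set n := Fintype.card α with hn
  have hn0 : 0 < n := Fintype.card_pos
  set J := agreeSet b b' with hJ
  set U := trailVerts len w J with hU
  set G := Finset.univ.filter fun r : (W ↪ α) × (W ↪ α) => ∀ u ∈ U, r.1 u = r.2 u with hG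
  set I : (W ↪ α) × (W ↪ α) → Finset (τ → α) := fun r =>
    windowEvent pos len w (b, r.1) ∩ windowEvent pos len w (b', r.2) with hI
  have hzero : ∀ r, r ∉ G → I r = ∅ := by
    intro r hr
    refine Finset.eq_empty_of_forall_notMem fun x hx => hr ?_
    obtain ⟨h1, h2⟩ := Finset.mem_inter.1 hx
    refine Finset.mem_filter.2 ⟨Finset.mem_univ _, fun u hu => ?_⟩
    obtain ⟨j, hj, hu⟩ := Finset.mem_biUnion.1 hu
    obtain ⟨i, hi, rfl⟩ := Finset.mem_image.1 hu
    have hi := Nat.lt_succ_iff.1 (Finset.mem_range.1 hi)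
    have hb : b j = b' j := (Finset.mem_filter.1 hj).2
    rw [← mem_windowEvent.1 h1 j i hi, ← mem_windowEvent.1 h2 j i hi]
    simp only [hb]
  have hbound : ∀ r, (I r).card * n ^ (2 * ∑ j, (len j + 1)) ≤
      n ^ Fintype.card τ * n ^ ∑ j ∈ J, (len j + 1) := by
    intro r
    have h1 := card_mul_le_of_agree (windowPositions pos len b Finset.univ ∪
      windowPositions pos len b' Finset.univ) (I r) (by
        intro x hx y hy p hp
        obtain ⟨hx1, hx2⟩ := Finset.mem_inter.1 hx
        obtain ⟨hy1, hy2⟩ := Finset.mem_inter.1 hy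
        rcases Finset.mem_union.1 hp with hp | hp <;>
          obtain ⟨j, -, i, hi, rfl⟩ := mem_windowPositions.1 hp
        · exact (mem_windowEvent.1 hx1 j i hi).trans (mem_windowEvent.1 hy1 j i hi).symm
        · exact (mem_windowEvent.1 hx2 j i hi).trans (mem_windowEvent.1 hy2 j i hi).symm)
    calc (I r).card * n ^ (2 * ∑ j, (len j + 1))
        ≤ (I r).card * n ^ ((windowPositions pos len b Finset.univ ∪
            windowPositions pos len b' Finset.univ).card + ∑ j ∈ J, (len j + 1)) :=
          Nat.mul_le_mul_left _ (Nat.pow_le_pow_right hn0 (hsep.card_union_windowPositions b b'))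
      _ ≤ _ := by
          rw [pow_add, ← mul_assoc]
          exact Nat.mul_le_mul_right _ h1
  have hsum : (∑ φ : W ↪ α, ∑ φ' : W ↪ α,
      (windowEvent pos len w (b, φ) ∩ windowEvent pos len w (b', φ')).card) =
      ∑ r ∈ G, (I r).card := by
    rw [← Fintype.sum_prod_type' fun φ φ' =>
      (windowEvent pos len w (b, φ) ∩ windowEvent pos len w (b', φ')).card]
    symm
    refine Finset.sum_subset (Finset.subset_univ G) fun r _ hr => ?_
    rw [hzero r hr, Finset.card_empty]
  have h2 : (∑ r ∈ G, (I r).card) * n ^ (2 * ∑ j, (len j + 1)) ≤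
      G.card * (n ^ Fintype.card τ * n ^ ∑ j ∈ J, (len j + 1)) := by
    rw [Finset.sum_mul, ← smul_eq_mul G.card]
    exact Finset.sum_le_card_nsmul _ _ _ fun r _ => hbound r
  have h3 : G.card * n ^ U.card ≤ n ^ (2 * Fintype.card W) := card_agree_mul_le U
  rw [hsum]
  calc _ = (∑ r ∈ G, (I r).card) * n ^ (2 * ∑ j, (len j + 1)) * n ^ U.card := by ring
    _ ≤ G.card * (n ^ Fintype.card τ * n ^ ∑ j ∈ J, (len j + 1)) * n ^ U.card :=
        Nat.mul_le_mul_right _ h2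
    _ = G.card * n ^ U.card * (n ^ Fintype.card τ * n ^ ∑ j ∈ J, (len j + 1)) := by ring
    _ ≤ n ^ (2 * Fintype.card W) * (n ^ Fintype.card τ * n ^ ∑ j ∈ J, (len j + 1)) :=
        Nat.mul_le_mul_right _ h3
    _ = _ := by ring

-- For fixed `b` the sum over `b'` factors over the trails; each factor is `m - 1 + c`, relaxed to
-- `m + c`.
open Classical in
theorem sum_pow_card_agreeSet_le {c : ℝ} (hc : 0 ≤ c) :
    ∑ b : ι → Fin m, ∑ b' : ι → Fin m, c ^ (agreeSet b b').card ≤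
      (m : ℝ) ^ Fintype.card ι * (m + c) ^ Fintype.card ι := by
  have h1 : ∀ b : ι → Fin m, ∑ b' : ι → Fin m, c ^ (agreeSet b b').card ≤
      (m + c) ^ Fintype.card ι := by
    intro b
    have h2 : ∀ b' : ι → Fin m, c ^ (agreeSet b b').card = ∏ j, if b j = b' j then c else 1 := by
      intro b'
      rw [Finset.prod_ite, Finset.prod_const, Finset.prod_const_one, mul_one]
      rfl
    rw [Finset.sum_congr rfl fun b' _ => h2 b', ← Fintype.piFinset_univ,
      ← Finset.prod_univ_sum (fun _ => Finset.univ) fun j a => if b j = a then c else 1,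
      ← Finset.card_univ, ← Finset.prod_const]
    refine Finset.prod_le_prod (fun j _ => Finset.sum_nonneg fun a _ => ?_) fun j _ => ?_
    · split_ifs <;> linarith
    · calc ∑ a : Fin m, (if b j = a then c else 1) ≤ ∑ a : Fin m, (1 + if b j = a then c else 0) :=
            Finset.sum_le_sum fun a _ => by split_ifs <;> linarith
        _ = m + c := by rw [Finset.sum_add_distrib]; simp
  calc _ ≤ ∑ _b : ι → Fin m, ((m : ℝ) + c) ^ Fintype.card ι := Finset.sum_le_sum fun b _ => h1 b
    _ = _ := by
      rw [Finset.sum_const, Finset.card_univ, Fintype.card_fun, Fintype.card_fin, nsmul_eq_mul, Nat.cast_pow]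

/-- Second moment bound: the windows contain a faithful copy of the whole family of trails with
high probability. -/
theorem second_moment (hsep : SeparatedWindows pos len) [Nonempty α] (hm : 0 < m) {θ : ℕ}
    (hθ : 0 < θ) (hsparse : ∀ J : Finset ι,
      2 * J.card + θ * ∑ j ∈ J, len j ≤ θ * (trailVerts len w J).card)
    (A : Finset (τ → α)) (hA : ∀ x, (∃ (b : ι → Fin m) (φ : W ↪ α),
      ∀ j, ∀ i ≤ len j, x (pos j (b j) i) = φ (w j i)) → x ∈ A) :
    (((Fintype.card α).descFactorial (Fintype.card W) : ℝ) /
          (Fintype.card α : ℝ) ^ Fintype.card W) ^ 2 *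
        ((m : ℝ) / (m + (Fintype.card α : ℝ) ^ (1 - 2 / (θ : ℝ)))) ^ Fintype.card ι ≤
      (A.card : ℝ) / (Fintype.card α : ℝ) ^ Fintype.card τ := by
  classical
  set n := Fintype.card α with hn
  set K := Fintype.card ι with hK
  set v := Fintype.card W with hv
  set Q := ∑ j, (len j + 1) with hQ
  set T := Fintype.card τ with hT
  set c : ℝ := (n : ℝ) ^ (1 - 2 / (θ : ℝ)) with hc
  have hn0 : 0 < n := Fintype.card_pos
  have hnR : (0 : ℝ) < n := by exact_mod_cast hn0
  have hn1 : (1 : ℝ) ≤ n := by exact_mod_cast hn0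
  have hmR : (0 : ℝ) < m := by exact_mod_cast hm
  have hθR : (0 : ℝ) < θ := by exact_mod_cast hθ
  have hc0 : 0 < c := Real.rpow_pos_of_pos hnR _
  set Ev : (ι → Fin m) × (W ↪ α) → Finset (τ → α) := windowEvent pos len w with hEv
  -- The number of pairs of windows and embedding that succeed; it vanishes outside `A`.
  set N : (τ → α) → ℝ := fun x => ∑ q, if x ∈ Ev q then 1 else 0 with hN
  have hfirst : ∑ x, N x = (m : ℝ) ^ K * (n.descFactorial v : ℝ) * ((n : ℝ) ^ T / (n : ℝ) ^ Q) := by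
    have h1 : ∀ q, ∑ x, (if x ∈ Ev q then (1 : ℝ) else 0) = (n : ℝ) ^ T / (n : ℝ) ^ Q := by
      intro q
      rw [Finset.sum_ite_mem, Finset.univ_inter, Finset.sum_const, nsmul_one,
        eq_div_iff (by positivity)]
      exact_mod_cast card_windowEvent hsep q
    rw [hN, Finset.sum_comm, Finset.sum_congr rfl fun q _ => h1 q, Finset.sum_const,
      Finset.card_univ, Fintype.card_prod, Fintype.card_fun, Fintype.card_fin,
      Fintype.card_embedding_eq, nsmul_eq_mul]
    push_cast
    rfl
  have hpair : ∀ b b' : ι → Fin m, ∑ φ : W ↪ α, ∑ φ' : W ↪ α,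
      ((Ev (b, φ) ∩ Ev (b', φ')).card : ℝ) ≤
        (n : ℝ) ^ (2 * v) * (n : ℝ) ^ T / (n : ℝ) ^ (2 * Q) * c ^ (agreeSet b b').card := by
    intro b b'
    set J := agreeSet b b' with hJ
    set U := trailVerts len w J with hU
    have h1 := sum_card_inter_windowEvent_le (w := w) (α := α) hsep b b'
    have h2 : (∑ φ : W ↪ α, ∑ φ' : W ↪ α, ((Ev (b, φ) ∩ Ev (b', φ')).card : ℝ)) *
        (n : ℝ) ^ U.card * (n : ℝ) ^ (2 * Q) ≤
        (n : ℝ) ^ (2 * v) * (n : ℝ) ^ T * (n : ℝ) ^ ∑ j ∈ J, (len j + 1) := by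
      exact_mod_cast h1
    -- Sparsity divided by `θ` reads `∑ len + (2/θ)|J| ≤ |U|`, that is, `∑ (len + 1) - |U| ≤ (1 -
    -- 2/θ)|J|`.
    have h3 : (n : ℝ) ^ ∑ j ∈ J, (len j + 1) ≤ c ^ J.card * (n : ℝ) ^ U.card := by
      rw [hc, ← Real.rpow_natCast, ← Real.rpow_natCast, ← Real.rpow_natCast, ← Real.rpow_mul hnR.le,
        ← Real.rpow_add hnR]
      refine Real.rpow_le_rpow_of_exponent_le hn1 ?_
      have h4 : (2 * J.card + θ * ∑ j ∈ J, len j : ℝ) ≤ θ * U.card := by exact_mod_cast hsparse J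
      have h5 : ((∑ j ∈ J, (len j + 1) : ℕ) : ℝ) = (∑ j ∈ J, len j : ℕ) + J.card := by
        rw [Finset.sum_add_distrib, Finset.sum_const, smul_eq_mul, mul_one,
          Nat.cast_add]
      rw [h5, ← mul_le_mul_iff_right₀ hθR]
      have h6 : (θ : ℝ) * ((1 - 2 / θ) * J.card + U.card) =
          θ * J.card - 2 * J.card + θ * U.card := by field_simp
      rw [h6, mul_add]
      linarith
    rw [div_mul_eq_mul_div, le_div_iff₀ (by positivity),
      ← mul_le_mul_iff_left₀ (pow_pos hnR U.card)]
    calc _ = (∑ φ : W ↪ α, ∑ φ' : W ↪ α, ((Ev (b, φ) ∩ Ev (b', φ')).card : ℝ)) *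
        (n : ℝ) ^ U.card * (n : ℝ) ^ (2 * Q) := by ring
      _ ≤ _ := h2
      _ ≤ (n : ℝ) ^ (2 * v) * (n : ℝ) ^ T * (c ^ J.card * (n : ℝ) ^ U.card) :=
          mul_le_mul_of_nonneg_left h3 (by positivity)
      _ = _ := by ring
  have hsecond : ∑ x, N x ^ 2 ≤
      (n : ℝ) ^ (2 * v) * (n : ℝ) ^ T / (n : ℝ) ^ (2 * Q) * ((m : ℝ) ^ K * (m + c) ^ K) := by
    have h1 : ∑ x, N x ^ 2 = ∑ b : ι → Fin m, ∑ b' : ι → Fin m, ∑ φ : W ↪ α, ∑ φ' : W ↪ α,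
        ((Ev (b, φ) ∩ Ev (b', φ')).card : ℝ) := by
      have h2 : ∀ x, N x ^ 2 = ∑ b : ι → Fin m, ∑ b' : ι → Fin m, ∑ φ : W ↪ α, ∑ φ' : W ↪ α,
          if x ∈ Ev (b, φ) ∩ Ev (b', φ') then (1 : ℝ) else 0 := by
        intro x
        simp only [hN, sq, Fintype.sum_prod_type, Finset.sum_mul_sum]
        refine Finset.sum_congr rfl fun b _ => Finset.sum_congr rfl fun b' _ =>
          Finset.sum_congr rfl fun φ _ => Finset.sum_congr rfl fun φ' _ => ?_
        by_cases h : x ∈ Ev (b, φ) <;> by_cases h' : x ∈ Ev (b', φ') <;> simp [h, h']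
      rw [Finset.sum_congr rfl fun x _ => h2 x, Finset.sum_comm]
      refine Finset.sum_congr rfl fun b _ => ?_
      rw [Finset.sum_comm]
      refine Finset.sum_congr rfl fun b' _ => ?_
      rw [Finset.sum_comm]
      refine Finset.sum_congr rfl fun φ _ => ?_
      rw [Finset.sum_comm]
      refine Finset.sum_congr rfl fun φ' _ => ?_
      rw [Finset.sum_ite_mem, Finset.univ_inter, Finset.sum_const, nsmul_one]
    rw [h1]
    refine (Finset.sum_le_sum fun b _ => Finset.sum_le_sum fun b' _ => hpair b b').trans ?_
    simp_rw [← Finset.mul_sum]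
    exact mul_le_mul_of_nonneg_left (sum_pow_card_agreeSet_le hc0.le) (by positivity)
  -- Cauchy–Schwarz on the support of `N`.
  have hCS : (∑ x, N x) ^ 2 ≤ A.card * ∑ x, N x ^ 2 := by
    have h1 : ∑ x, N x = ∑ x ∈ A, N x := by
      symm
      refine Finset.sum_subset (Finset.subset_univ A) fun x _ hx => ?_
      refine Finset.sum_eq_zero fun q _ => if_neg fun h => hx ?_
      exact hA x ⟨q.1, q.2, mem_windowEvent.1 h⟩
    rw [h1]
    refine sq_sum_le_card_mul_sum_sq.trans (mul_le_mul_of_nonneg_left ?_ (by positivity))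
    exact Finset.sum_le_sum_of_subset_of_nonneg (Finset.subset_univ A) fun x _ _ => sq_nonneg _
  have hfinal := hCS.trans (mul_le_mul_of_nonneg_left hsecond (Nat.cast_nonneg A.card))
  rw [hfirst] at hfinal
  rw [le_div_iff₀ (by positivity), ← mul_le_mul_iff_left₀ (show 0 <
    (n : ℝ) ^ (2 * v) * (n : ℝ) ^ T / (n : ℝ) ^ (2 * Q) * ((m : ℝ) ^ K * (m + c) ^ K) by positivity)]
  refine le_trans (le_of_eq ?_) hfinal
  have : (m : ℝ) + c ≠ 0 := by positivity
  rw [div_pow, div_pow]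
  field_simp
  ring

end SecondMoment

end WalkTrace

namespace WalkTrace

/-! ### Placing disjoint windows in time -/

section Windows

theorem exists_windows {ι : Type*} [Fintype ι] {len : ι → ℕ} {L m t : ℕ}
    (hlen : ∀ j, len j < L) (h : m * (Fintype.card ι * L) ≤ t + 1) :
    ∃ pos : ι → Fin m → ℕ → Fin (t + 1), SeparatedWindows pos len ∧
      ∀ j a, ∀ i < len j, (pos j a (i + 1) : ℕ) = pos j a i + 1 := by
  set K := Fintype.card ι with hK
  set ε : ι ≃ Fin K := Fintype.equivFin ι with hε
  -- Time is cut into blocks of length `L`, numbered by pairs `(j, a)` in mixed radix. As `len j <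
  -- L`, all `len j + 1` positions of a window fit in one block, and the digits are recovered modulo
  -- `L` and `m`.
  set P : ι → Fin m → ℕ → ℕ := fun j a i => (ε j * m + a) * L + i with hP
  have hlt : ∀ j a, ∀ i ≤ len j, P j a i < t + 1 := by
    intro j a i hi
    have hi : i < L := lt_of_le_of_lt hi (hlen j)
    have h1 : (ε j : ℕ) * m + a < K * m := by
      have := Nat.mul_le_mul_right m (ε j).2
      rw [Nat.succ_mul] at this
      have := a.2
      omega
    have h2 := Nat.mul_le_mul_right L h1
    rw [Nat.succ_mul] at h2
    have h3 : m * (K * L) = K * m * L := by ring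
    simp only [hP]
    omega
  -- The reduction modulo `t + 1` in `Fin.ofNat` does nothing inside a window.
  have hval : ∀ j a, ∀ i ≤ len j, (Fin.ofNat (t + 1) (P j a i) : ℕ) = P j a i := fun j a i hi =>
    Nat.mod_eq_of_lt (hlt j a i hi)
  refine ⟨fun j a i => Fin.ofNat (t + 1) (P j a i), ?_, fun j a i hi => ?_⟩
  · intro j a i j' a' i' hi hi' heq
    have hL := lt_of_le_of_lt hi (hlen j)
    have hL' := lt_of_le_of_lt hi' (hlen j')
    have h1 : P j a i = P j' a' i' := by rw [← hval j a i hi, ← hval j' a' i' hi']; exact congrArg Fin.val heq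
    have h2 : i = i' := by
      have := congrArg (· % L) h1
      simpa [hP, Nat.mul_add_mod', Nat.mod_eq_of_lt hL, Nat.mod_eq_of_lt hL'] using this
    subst h2
    have h3 : (ε j : ℕ) * m + a = ε j' * m + a' :=
      Nat.eq_of_mul_eq_mul_right (Nat.zero_lt_of_lt hL) (Nat.add_right_cancel h1)
    have h4 : (a : ℕ) = a' := by
      have := congrArg (· % m) h3
      simpa [Nat.mul_add_mod', Nat.mod_eq_of_lt a.2, Nat.mod_eq_of_lt a'.2] using this
    have h5 : (ε j : ℕ) = ε j' :=
      Nat.eq_of_mul_eq_mul_right (Nat.zero_lt_of_lt a.2) (by omega)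
    exact ⟨ε.injective (Fin.ext h5), Fin.ext h4, rfl⟩
  · rw [hval j a i hi.le, hval j a (i + 1) hi]
    rfl

theorem IsTrailDecomposition.isContained_trace {ι W α : Type*} {F : SimpleGraph W} {len : ι → ℕ}
    {w : ι → ℕ → W} (hd : IsTrailDecomposition F len w) {m t : ℕ}
    {pos : ι → Fin m → ℕ → Fin (t + 1)}
    (hpos : ∀ j a, ∀ i < len j, (pos j a (i + 1) : ℕ) = pos j a i + 1)
    (x : Fin (t + 1) → α) (b : ι → Fin m) (φ : W ↪ α)
    (h : ∀ j, ∀ i ≤ len j, x (pos j (b j) i) = φ (w j i)) : F.IsContained (trace x) := by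
  refine ⟨⟨⟨φ, fun {u v} huv => ?_⟩, φ.injective⟩⟩
  refine (SimpleGraph.fromEdgeSet_adj _).2 ⟨?_, φ.injective.ne huv.ne⟩
  obtain ⟨j, i, hi, he⟩ := hd.cover u v huv
  have hs := hpos j (b j) i hi
  have hlt : (pos j (b j) i : ℕ) < t := by have := (pos j (b j) (i + 1)).2; omega
  refine ⟨⟨pos j (b j) i, hlt⟩, ?_⟩
  have h1 : (⟨pos j (b j) i, hlt⟩ : Fin t).castSucc = pos j (b j) i := Fin.ext rfl
  have h2 : (⟨pos j (b j) i, hlt⟩ : Fin t).succ = pos j (b j) (i + 1) := Fin.ext hs.symm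
  rw [h1, h2, h j i hi.le, h j (i + 1) hi, ← Sym2.map_mk, ← Sym2.map_mk, he]

end Windows

/-! ### The two limits -/

section Limits

variable {W : Type*} {F : SimpleGraph W} {t : ℕ+ → ℕ} {θ : ℕ}

theorem rpow_one_sub_le (n : ℕ+) (θ : ℕ) : ((n : ℕ) : ℝ) ^ (1 - 2 / (θ : ℝ)) ≤ (n : ℕ) := by
  have hn : (1 : ℝ) ≤ (n : ℕ) := by exact_mod_cast n.pos
  calc _ ≤ ((n : ℕ) : ℝ) ^ (1 : ℝ) := by
        refine Real.rpow_le_rpow_of_exponent_le hn ?_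
        have : (0 : ℝ) ≤ 2 / θ := by positivity
        linarith
    _ = _ := Real.rpow_one _

theorem one_le_rpow_one_sub (n : ℕ+) (hθ : 2 ≤ θ) :
    1 ≤ ((n : ℕ) : ℝ) ^ (1 - 2 / (θ : ℝ)) := by
  have hn : (1 : ℝ) ≤ (n : ℕ) := by exact_mod_cast n.pos
  refine Real.one_le_rpow hn ?_
  have h2 : (2 : ℝ) ≤ θ := by exact_mod_cast hθ
  have : 2 / (θ : ℝ) ≤ 1 := div_le_one_of_le₀ h2 (by linarith)
  linarith

theorem tendsto_containProb_zero [Finite W] (hθ0 : θ ≠ 0) (C : F.ConnectedComponent)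
    (hC : oddCount C.toSimpleGraph = θ)
    (ht : Tendsto (fun n : ℕ+ => (t n : ℝ) / ((n : ℕ) : ℝ) ^ (1 - 2 / (θ : ℝ))) atTop (𝓝 0)) :
    Tendsto (fun n : ℕ+ => containProb F (⊤ : SimpleGraph (Fin (n : ℕ))) (t n)) atTop (𝓝 0) := by
  classical
  have := Fintype.ofFinite C
  simp only [containProb_top, Fintype.card_fin]
  rw [← ENNReal.ofReal_zero]
  refine ENNReal.tendsto_ofReal ?_
  have hθR : (0 : ℝ) < θ := by exact_mod_cast Nat.pos_of_ne_zero hθ0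
  have hlim := (ht.rpow_const (p := (θ : ℝ) / 2) (Or.inr (by positivity))).const_mul
    ((Nat.card C.toSimpleGraph.edgeSet + 1) * (2 ^ (Nat.card C.toSimpleGraph.edgeSet *
      Nat.card C.toSimpleGraph.edgeSet) * (Nat.card C.toSimpleGraph.edgeSet + 1) ^
        (2 * Nat.card C.toSimpleGraph.edgeSet)) : ℝ)
  rw [Real.zero_rpow (by positivity), mul_zero] at hlim
  refine tendsto_of_tendsto_of_tendsto_of_le_of_le' tendsto_const_nhds hlim
    (Eventually.of_forall fun n => by positivity) ?_
  filter_upwards [ht.eventually_lt_const zero_lt_one] with n hn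
  have hc : (0 : ℝ) < ((n : ℕ) : ℝ) ^ (1 - 2 / (θ : ℝ)) :=
    Real.rpow_pos_of_pos (by exact_mod_cast n.pos) _
  -- Below the threshold `t` is eventually less than `n ^ (1 - 2/θ) ≤ n`, as the first moment bound
  -- requires.
  have htn : t n ≤ Fintype.card (Fin (n : ℕ)) := by
    rw [Fintype.card_fin]
    rw [div_lt_one hc] at hn
    exact_mod_cast hn.le.trans (rpow_one_sub_le n θ)
  have h1 := card_isContained_le_rpow (α := Fin (n : ℕ)) C.connected_toSimpleGraph (t n) htn
    (hC ▸ hθ0)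
  rw [hC, Fintype.card_fin] at h1
  refine le_trans ?_ h1
  refine div_le_div_of_nonneg_right ?_ (by positivity)
  refine Nat.cast_le.2 (Finset.card_le_card fun x hx => ?_)
  rw [Finset.mem_filter] at hx ⊢
  exact ⟨hx.1, SimpleGraph.IsContained.trans ⟨⟨C.toSimpleGraph_hom, Subtype.val_injective⟩⟩ hx.2⟩

theorem tendsto_descFactorial_div_pow (k : ℕ) :
    Tendsto (fun n : ℕ+ => ((n : ℕ).descFactorial k : ℝ) / ((n : ℕ) : ℝ) ^ k) atTop (𝓝 1) := by
  have hz : ∀ᶠ n : ℕ in atTop, ((n : ℝ) ^ k) ≠ 0 := by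
    filter_upwards [eventually_gt_atTop 0] with n hn
    positivity
  exact ((Asymptotics.isEquivalent_iff_tendsto_one hz).1 (isEquivalent_descFactorial k)).comp
    tendsto_PNat_val_atTop_atTop

theorem tendsto_containProb_one {ι : Type*} [Fintype ι] [Finite W] {len : ι → ℕ} {w : ι → ℕ → W}
    (hd : IsTrailDecomposition F len w) (hF : F.IsAcyclic) (hι : Nonempty ι) (hθ2 : 2 ≤ θ)
    (hθ : ∀ C : F.ConnectedComponent, oddCount C.toSimpleGraph ≤ θ)
    (ht : Tendsto (fun n : ℕ+ => (t n : ℝ) / ((n : ℕ) : ℝ) ^ (1 - 2 / (θ : ℝ))) atTop atTop) :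
    Tendsto (fun n : ℕ+ => containProb F (⊤ : SimpleGraph (Fin (n : ℕ))) (t n)) atTop (𝓝 1) := by
  classical
  have := Fintype.ofFinite W
  simp only [containProb_top, Fintype.card_fin]
  rw [← ENNReal.ofReal_one]
  refine ENNReal.tendsto_ofReal ?_
  set L := Finset.univ.sup len + 1 with hL
  have hlen : ∀ j, len j < L := fun j => Nat.lt_succ_of_le (Finset.le_sup (Finset.mem_univ j))
  set M := Fintype.card ι * L with hM
  have hM0 : 0 < M := Nat.mul_pos Fintype.card_pos (Nat.succ_pos _)
  have hMR : (0 : ℝ) < M := by exact_mod_cast hM0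
  set c : ℕ+ → ℝ := fun n => ((n : ℕ) : ℝ) ^ (1 - 2 / (θ : ℝ)) with hc
  set m : ℕ+ → ℕ := fun n => (t n + 1) / M with hm
  have hc1 : ∀ n, 1 ≤ c n := fun n => one_le_rpow_one_sub n hθ2
  -- Since `θ ≥ 2` gives `c n ≥ 1`, the divergence of `t / c` forces `t` itself to exceed any
  -- constant, so that at least one window per trail exists.
  have hlarge : ∀ᶠ n in atTop, M ≤ t n := by
    filter_upwards [ht.eventually_ge_atTop (M : ℝ)] with n hn
    have h1 := hc1 n
    rw [le_div_iff₀ (by linarith)] at hn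
    have h2 : (M : ℝ) ≤ t n := le_trans (by nlinarith) hn
    exact_mod_cast h2
  have hmt : ∀ n, M ≤ t n → 0 < m n ∧ (t n : ℝ) ≤ 2 * M * m n := by
    intro n hn
    have h0 : 0 < m n := Nat.div_pos (by omega) hM0
    refine ⟨h0, ?_⟩
    have h1 : t n + 1 < M * (m n + 1) := Nat.lt_mul_div_succ _ hM0
    have h2 : M ≤ M * m n := Nat.le_mul_of_pos_right M h0
    have h3 : t n ≤ 2 * M * m n := by
      rw [Nat.mul_add, Nat.mul_one] at h1
      rw [Nat.mul_assoc]
      omega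
    exact_mod_cast h3
  -- Rounding costs at most a factor 2: `t ≤ 2 M m`, hence `c / m ≤ 2 M (c / t)`.
  have hcm : Tendsto (fun n => c n / m n) atTop (𝓝 0) := by
    have h1 := (tendsto_inv_atTop_zero.comp ht).const_mul (2 * M : ℝ)
    rw [mul_zero] at h1
    refine tendsto_of_tendsto_of_tendsto_of_le_of_le' tendsto_const_nhds h1
      (Eventually.of_forall fun n => div_nonneg (by linarith [hc1 n]) (Nat.cast_nonneg _)) ?_
    filter_upwards [hlarge] with n hn
    obtain ⟨h0, h2⟩ := hmt n hn
    have hm0 : (0 : ℝ) < m n := by exact_mod_cast h0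
    have ht0 : (0 : ℝ) < t n := by exact_mod_cast lt_of_lt_of_le hM0 hn
    have hcn := hc1 n
    simp only [Function.comp_apply, inv_div]
    rw [← mul_div_assoc, div_le_div_iff₀ hm0 ht0]
    nlinarith
  have hlow : Tendsto (fun n : ℕ+ => (((n : ℕ).descFactorial (Fintype.card W) : ℝ) /
      ((n : ℕ) : ℝ) ^ Fintype.card W) ^ 2 * (1 / (1 + c n / m n)) ^ Fintype.card ι)
      atTop (𝓝 1) := by
    have h1 := (tendsto_descFactorial_div_pow (Fintype.card W)).pow 2
    have h2 : Tendsto (fun n => (1 / (1 + c n / m n)) ^ Fintype.card ι) atTop (𝓝 1) := by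
      have h3 := ((tendsto_const_nhds (x := (1 : ℝ))).add hcm)
      rw [add_zero] at h3
      have h4 := ((tendsto_const_nhds (x := (1 : ℝ))).div h3 one_ne_zero).pow (Fintype.card ι)
      simpa using h4
    simpa using h1.mul h2
  refine tendsto_of_tendsto_of_tendsto_of_le_of_le' hlow tendsto_const_nhds ?_
    (Eventually.of_forall fun n => ?_)
  · filter_upwards [hlarge] with n hn
    obtain ⟨h0, -⟩ := hmt n hn
    have hm0 : (0 : ℝ) < m n := by exact_mod_cast h0
    obtain ⟨pos, hsep, hpos⟩ := exists_windows hlen (Nat.div_mul_le_self (t n + 1) M)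
    have h1 := second_moment (α := Fin (n : ℕ)) hsep h0 (by omega : 0 < θ) (hd.sparse hF hθ)
      (Finset.univ.filter fun x => F.IsContained (trace x))
      fun x ⟨b, φ, hx⟩ => Finset.mem_filter.2
        ⟨Finset.mem_univ _, hd.isContained_trace hpos x b φ hx⟩
    rw [Fintype.card_fin, Fintype.card_fin] at h1
    refine le_trans (le_of_eq ?_) h1
    congr 2
    change 1 / (1 + c n / m n) = m n / (m n + c n)
    field_simp
  · refine div_le_one_of_le₀ ?_ (by positivity)
    have h1 := Finset.card_filter_le (Finset.univ : Finset (Fin (t n + 1) → Fin (n : ℕ)))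
      fun x => F.IsContained (trace x)
    rw [Finset.card_univ, Fintype.card_fun, Fintype.card_fin, Fintype.card_fin] at h1
    exact_mod_cast h1

end Limits

end WalkTrace

theorem corollary5 {W : Type*} [Finite W] (F : SimpleGraph W)
    (hF : F.IsAcyclic) (hne : F ≠ ⊥) (θ : ℕ)
    (hθ : IsGreatest
      (Set.range fun C : F.ConnectedComponent => WalkTrace.oddCount C.toSimpleGraph) θ)
    (t : ℕ+ → ℕ) :
    (Tendsto (fun n : ℕ+ => (t n : ℝ) / ((n : ℕ) : ℝ) ^ (1 - 2 / (θ : ℝ))) atTop (𝓝 0) →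
      Tendsto (fun n : ℕ+ =>
        WalkTrace.containProb F (⊤ : SimpleGraph (Fin (n : ℕ))) (t n)) atTop (𝓝 0)) ∧
    (Tendsto (fun n : ℕ+ => (t n : ℝ) / ((n : ℕ) : ℝ) ^ (1 - 2 / (θ : ℝ))) atTop atTop →
      Tendsto (fun n : ℕ+ =>
        WalkTrace.containProb F (⊤ : SimpleGraph (Fin (n : ℕ))) (t n)) atTop (𝓝 1)) := by
  obtain ⟨⟨C, hC⟩, hub⟩ := hθ
  have hle : ∀ C : F.ConnectedComponent, WalkTrace.oddCount C.toSimpleGraph ≤ θ :=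
    fun C => hub ⟨C, rfl⟩
  obtain ⟨ι, _, len, w, hd⟩ := WalkTrace.exists_isTrailDecomposition F hF
  obtain ⟨a, b, hab⟩ := SimpleGraph.ne_bot_iff_exists_adj.1 hne
  obtain ⟨j, -⟩ := hd.cover a b hab
  -- An edge lies on some trail, whose two ends are odd vertices of one component.
  have hθ2 : 2 ≤ θ := by
    have h1 := hd.two_mul_card_le (F.connectedComponentMk (w j 0)) {j} fun i hi => by
      rw [Finset.mem_singleton.1 hi]
    rw [Finset.card_singleton] at h1
    exact h1.trans (hle _)
  exact ⟨WalkTrace.tendsto_containProb_zero (by omega) C hC,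
    WalkTrace.tendsto_containProb_one hd hF ⟨j⟩ hθ2 hle⟩
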